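/- Let $n\ge 1$, $\mathcal O=\mathbb C[[t]]$, $\mathcal K=\mathbb C((t))$, and let $\mathcal G'=PGL_n(\mathcal K)/PGL_n(\mathcal O)$ be the affine Grassmannian of $PSL_n(\mathbb C)=PGL_n(\mathbb C)$, on which $SL_n(\mathcal K)$ acts. A gallery is a finite sequence $\gamma=(\underline{i}_1,\dots,\underline{i}_r)$ of nonempty strictly increasing sequences $\underline i_j$ of elements of $\{1,\dots,n\}$; equivalently it is a key tableau, whose $j$-th column counted from the right has the entries $\underline i_j$ from top to bottom. Its word $w_\gamma$ is the concatenation $\underline i_1\underline i_2\cdots\underline i_r$ (the tableau read column by column, starting with the right-most column, each column from top to bottom). For $\underline i=(i_1,\dots,i_d)$ put $\epsilon_{\underline i}=\epsilon_{i_1}+\dots+\epsilon_{i_d}$, regarded as a coweight, i.e. in $\mathbb Z^n/\mathbb Z(1,\dots,1)$, and let $\mu_j=\epsilon_{\underline i_1}+\dots+\epsilon_{\underline i_j}$ for $0\le j\le r$. For a coweight $\mu$ let $$\mathcal P_\mu=\{g\in SL_n(\mathcal K)\mid \text{the coefficient of } t^k \text{ in } g_{ab} \text{ is } 0 \text{ whenever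 } (\mu_a-\mu_b)+k<0\}$$ be the parahoric subgroup containing the root subgroups of the affine roots $(\alpha,k)$ with $(\alpha,\mu)+k\ge 0$, and denote again by $\mu\in\mathcal G'$ the point with stabilizer $\mathcal P_\mu$ given by the coset of the diagonal matrix $\mathrm{diag}(t^{-\mu_1},\dots,t^{-\mu_n})$. Put $\mathcal Q_j=\mathcal P_{\mu_j}\cap\mathcal P_{\mu_{j+1}}$ for $0\le j<r$. The Bott-Samelson variety (with center $\gamma$) is $$\Sigma=\mathcal P_{\mu_0}\times_{\mathcal Q_0}\mathcal P_{\mu_1}\times_{\mathcal Q_1}\cdots\times_{\mathcal Q_{r-1}}\mathcal P_{\mu_r}/\mathcal P_{\mu_r},$$ the quotient of $\mathcal P_{\mu_0}\times\dots\times\mathcal P_{\mu_r}$ by the action $(q_0,\dots,q_r)\circ(p_0,\dots,p_r)=(p_0q_0,\,q_0^{-1}p_1q_1,\dots,\,q_{r-1}^{-1}p_rq_r)$ of $\mathcal Q_0\times\dots\times\mathcal Q_{r-1}\times\mathcal P_{\mu_r}$, with its classical topology (the quotient topology, where the product of the $\mathcal P_{\mu_j}$ has the topology of coefficientwise convergence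 of matrix entries). Let $\pi:\Sigma\to\mathcal G'$, $[p_0,\dots,p_r]\mapsto p_0\cdots p_{r-1}.\mu_r$. Fix a generic anti-dominant one parameter subgroup $\eta:\mathbb C^*\to T$, $\eta(s)=\mathrm{diag}(s^{a_1},\dots,s^{a_n})$ with integers $a_1<\dots<a_n$, $\sum a_i=0$, acting on $\Sigma$ by $\eta(s).[p_0,p_1,\dots,p_r]=[\eta(s)p_0,p_1,\dots,p_r]$. The cell of $\gamma$ is $$C_\gamma=\{x\in\Sigma\mid \lim_{s\to 0}\eta(s).x=[1,\dots,1]\},$$ where $[1,\dots,1]$ is the torus fixed point corresponding to $\gamma$, and $Z_\gamma=\pi(C_\gamma)\subseteq\mathcal G'$. **Proposition.** The image $Z_\gamma$ depends only on the word $w_\gamma$: if $\gamma,\gamma'$ are galleries (possibly of different types) with $w_\gamma=w_{\gamma'}$, then $Z_\gamma=Z_{\gamma'}$. -/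

import Mathlib

noncomputable section

namespace LoopGallery

open Filter Topology
open scoped MatrixGroups

/-! ### Galleries (key tableaux) and words over the alphabet `Fin n` -/

/-- A column: a nonempty strictly increasing sequence of letters, listed from top to bottom. -/
def Column (n : ℕ) : Type := {l : List (Fin n) // l ≠ [] ∧ l.Pairwise (· < ·)}

/-- A gallery `γ = (i₁, …, i_r)`: a finite sequence of columns.  It is the same thing as the key
tableau whose `j`-th column, counted from right to left, is `i_j`. -/
abbrev Gallery (n : ℕ) : Type := List (Column n)

/-- The word of a gallery: the key tableau is read column by column, the right-most column first,
and each column is read from top to bottom. -/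
def Gallery.word {n : ℕ} (γ : Gallery n) : List (Fin n) := (γ.map Subtype.val).flatten

/-- The coweight `ε_{i₁} + … + ε_{i_d}` of a column.  Coweights are elements of
`ℤⁿ / ℤ (1, …, 1)`; we work with representatives in `ℤⁿ`. -/
def columnCoweight {n : ℕ} (c : Column n) : Fin n → ℤ := fun a => if a ∈ c.1 then 1 else 0

/-- The polyline of a gallery: its `j`-th vertex `μ_j` is the sum of the coweights of the first
`j` columns, for `j = 0, …, r`. -/
def vertex {n : ℕ} (γ : Gallery n) (j : ℕ) : Fin n → ℤ := ((γ.take j).map columnCoweight).sum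

/-! ### The loop group and the affine Grassmannian of `PSL_n` -/

/-- The ring of formal power series `ℂ[[t]]`. -/
abbrev 𝒪 : Type := PowerSeries ℂ

/-- The field of formal Laurent series `ℂ((t))`. -/
abbrev 𝒦 : Type := LaurentSeries ℂ

/-- The image of `GL_n(𝒪)` in the group `PGL_n(𝒦)` of `𝒦`-points of the adjoint group. -/
def adjointIntegral (n : ℕ) : Subgroup PGL(n, 𝒦) :=
  ((Matrix.ProjGenLinGroup.mk (n := Fin n) (R := 𝒦)).comp
    (Matrix.GeneralLinearGroup.map (algebraMap 𝒪 𝒦))).range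

/-- The affine Grassmannian `G'(𝒦) / G'(𝒪)` of the adjoint group `G' = PSL_n(ℂ) = PGL_n(ℂ)`. -/
abbrev AffineGrassmannian (n : ℕ) : Type := PGL(n, 𝒦) ⧸ adjointIntegral n

/-- The diagonal matrix `t^{-μ}`, with diagonal entries `t^{-μ_a}`. -/
def translation {n : ℕ} (μ : Fin n → ℤ) : GL (Fin n) 𝒦 where
  val := Matrix.diagonal fun a => HahnSeries.single (-μ a) 1
  inv := Matrix.diagonal fun a => HahnSeries.single (μ a) 1
  val_inv := by simp [Matrix.diagonal_mul_diagonal]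
  inv_val := by simp [Matrix.diagonal_mul_diagonal]

/-- The torus fixed point of the affine Grassmannian attached to a coweight: the coset of
`t^{-μ}`, whose stabilizer in `SL_n(𝒦)` is the parahoric subgroup of `μ`. -/
def coweightPoint {n : ℕ} (μ : Fin n → ℤ) : AffineGrassmannian n :=
  (QuotientGroup.mk (Matrix.ProjGenLinGroup.mk (translation μ)))

/-- `SL_n(𝒦)` acts on the affine Grassmannian of `PSL_n` through `SL_n(𝒦) → PGL_n(𝒦)`. -/
def loopAct {n : ℕ} (g : SL(n, 𝒦)) (x : AffineGrassmannian n) : AffineGrassmannian n :=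
  Matrix.SpecialLinearGroup.toPGL g • x

/-! ### Parahoric subgroups -/

/-- The entries of `g` only involve the affine roots `(ε_a - ε_b, k)` with
`(ε_a - ε_b, μ) + k ≥ 0`: the coefficient of `t^k` in the entry `(a, b)` vanishes otherwise. -/
def InParahoric {n : ℕ} (μ : Fin n → ℤ) (g : SL(n, 𝒦)) : Prop :=
  ∀ (a b : Fin n) (k : ℤ), (μ a - μ b) + k < 0 → (g a b).coeff k = 0

theorem exists_powerSeries_iff (m : ℤ) (f : 𝒦) :
    (∃ h : 𝒪, f = HahnSeries.single m 1 * algebraMap 𝒪 𝒦 h) ↔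
      ∀ k : ℤ, k < m → f.coeff k = 0 := by
  constructor
  · rintro ⟨h, rfl⟩ k hk
    rw [HahnSeries.coeff_single_mul, one_mul, LaurentSeries.coe_algebraMap]
    have hneg : k - m < 0 := by omega
    rw [HahnSeries.ofPowerSeries_apply]
    apply HahnSeries.embDomain_of_notMem_range
    rintro ⟨j, hj⟩
    simp at hj
    omega
  · intro hf
    refine ⟨PowerSeries.mk fun j => f.coeff (m + j), ?_⟩
    ext k
    rw [HahnSeries.coeff_single_mul, one_mul]
    by_cases hk : k < m
    · rw [hf k hk]
      symm
      rw [LaurentSeries.coe_algebraMap, HahnSeries.ofPowerSeries_apply]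
      apply HahnSeries.embDomain_of_notMem_range
      rintro ⟨j, hj⟩
      simp at hj
      omega
    · obtain ⟨j, hj⟩ := Int.eq_ofNat_of_zero_le (show 0 ≤ k - m by omega)
      rw [hj, LaurentSeries.coe_algebraMap, LaurentSeries.coeff_coe_powerSeries,
        PowerSeries.coeff_mk]
      congr 1
      omega

/-- An element satisfies the entrywise condition at `μ` exactly if it is conjugate under `t^{-μ}`
to an element of `SL_n(𝒪)`. -/
theorem inParahoric_iff {n : ℕ} (μ : Fin n → ℤ) (g : SL(n, 𝒦)) :
    InParahoric μ g ↔ ∃ h : SL(n, 𝒪),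
      Matrix.SpecialLinearGroup.toGL g * translation μ =
        translation μ * Matrix.SpecialLinearGroup.mapGL 𝒦 h := by
  have key : ∀ h : Matrix (Fin n) (Fin n) 𝒪,
      (g.1 * (translation μ).1 = (translation μ).1 * h.map (algebraMap 𝒪 𝒦)) ↔
        ∀ a b, g a b = HahnSeries.single (μ b - μ a) 1 * algebraMap 𝒪 𝒦 (h a b) := by
    intro h
    rw [← Matrix.ext_iff]
    refine forall_congr' fun a => forall_congr' fun b => ?_
    simp only [translation, Matrix.mul_diagonal, Matrix.diagonal_mul, Matrix.map_apply]
    have e1 : (HahnSeries.single (-μ b) (1 : ℂ)) * HahnSeries.single (μ b) 1 = 1 := by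
      simp
    have e2 : (HahnSeries.single (μ b) (1 : ℂ)) * HahnSeries.single (-μ a) 1 =
        HahnSeries.single (μ b - μ a) 1 := by
      simp [HahnSeries.single_mul_single, sub_eq_add_neg]
    rw [← e2]
    constructor
    · intro H
      calc g.1 a b = (g.1 a b * HahnSeries.single (-μ b) 1) * HahnSeries.single (μ b) 1 := by
            rw [mul_assoc, e1, mul_one]
        _ = _ := by rw [H]; ring
    · intro H
      change g.1 a b = _ at H
      rw [H]
      calc _ = HahnSeries.single (-μ a) 1 * algebraMap 𝒪 𝒦 (h a b) *
            (HahnSeries.single (-μ b) (1 : ℂ) * HahnSeries.single (μ b) 1) := by ring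
        _ = _ := by rw [e1, mul_one]
  constructor
  · intro hg
    have : ∀ a b, ∃ f : 𝒪, g a b = HahnSeries.single (μ b - μ a) 1 * algebraMap 𝒪 𝒦 f :=
      fun a b => (exists_powerSeries_iff _ _).2 fun k hk => hg a b k (by omega)
    choose f hf using this
    have hmat := (key (Matrix.of f)).2 hf
    have hdet : (Matrix.of f).det = 1 := by
      have h1 := congrArg Matrix.det hmat
      rw [Matrix.det_mul, Matrix.det_mul, g.2, one_mul] at h1
      have hu : ((translation μ).1).det ≠ 0 :=
        (((Matrix.isUnit_iff_isUnit_det _).1 (translation μ).isUnit)).ne_zero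
      have h2 : ((Matrix.of f).map (algebraMap 𝒪 𝒦)).det = 1 :=
        mul_left_cancel₀ hu (by rw [← h1, mul_one])
      have h3 : algebraMap 𝒪 𝒦 (Matrix.of f).det = algebraMap 𝒪 𝒦 1 := by
        rw [map_one, ← h2, RingHom.map_det]
        rfl
      exact IsFractionRing.injective 𝒪 𝒦 h3
    refine ⟨⟨Matrix.of f, hdet⟩, ?_⟩
    apply Units.ext
    exact hmat
  · rintro ⟨h, hh⟩ a b k hk
    have h1 := congrArg Units.val hh
    have h2 := (key h.1).1 h1 a b
    exact (exists_powerSeries_iff (μ b - μ a) (g a b)).1 ⟨_, h2⟩ k (by omega)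

/-- The parahoric subgroup `𝒫_μ` of `SL_n(𝒦)` attached to a coweight `μ`: it contains the torus
and the root subgroups of the affine roots that are nonnegative at `μ`. -/
def parahoric {n : ℕ} (μ : Fin n → ℤ) : Subgroup SL(n, 𝒦) where
  carrier := {g | InParahoric μ g}
  mul_mem' := by
    intro g g' hg hg'
    obtain ⟨h, hh⟩ := (inParahoric_iff _ _).1 hg
    obtain ⟨h', hh'⟩ := (inParahoric_iff _ _).1 hg'
    refine (inParahoric_iff _ _).2 ?_
    exact ⟨h * h', by rw [map_mul, map_mul, mul_assoc, hh', ← mul_assoc, hh, mul_assoc]⟩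
  one_mem' := (inParahoric_iff _ _).2 ⟨1, by simp⟩
  inv_mem' := by
    intro g hg
    obtain ⟨h, hh⟩ := (inParahoric_iff _ _).1 hg
    refine (inParahoric_iff _ _).2 ⟨h⁻¹, ?_⟩
    rw [map_inv, map_inv, inv_mul_eq_iff_eq_mul, ← mul_assoc, hh, mul_assoc, mul_inv_cancel,
      mul_one]

/-- `𝒫_μ` fixes the point of the affine Grassmannian attached to `μ`. -/
theorem loopAct_coweightPoint {n : ℕ} (μ : Fin n → ℤ) (g : SL(n, 𝒦)) (hg : g ∈ parahoric μ) :
    loopAct g (coweightPoint μ) = coweightPoint μ := by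
  obtain ⟨h, hh⟩ := (inParahoric_iff μ g).1 hg
  unfold loopAct coweightPoint
  change QuotientGroup.mk (Matrix.ProjGenLinGroup.mk (Matrix.SpecialLinearGroup.toGL g) *
    Matrix.ProjGenLinGroup.mk (translation μ)) = _
  rw [← map_mul, hh, map_mul]
  symm
  rw [QuotientGroup.eq, inv_mul_cancel_left]
  refine ⟨Matrix.SpecialLinearGroup.toGL h, ?_⟩
  refine congrArg Matrix.ProjGenLinGroup.mk (Units.ext ?_)
  ext a b
  simp [Matrix.SpecialLinearGroup.mapGL, Matrix.GeneralLinearGroup.map]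

/-! ### Bott-Samelson varieties -/

/-- The group `𝒬_j`: for `j < r` it is the parahoric subgroup of the segment `[μ_j, μ_{j+1}]`,
given by the affine roots that are nonnegative on the segment, i.e. at both end points; for
`j = r` it is `𝒫_{μ_r}`. -/
def segmentGroup {n : ℕ} (γ : Gallery n) (j : ℕ) : Subgroup SL(n, 𝒦) :=
  if j < γ.length then parahoric (vertex γ j) ⊓ parahoric (vertex γ (j + 1))
  else parahoric (vertex γ j)

/-- The product `𝒫_{μ_0} × 𝒫_{μ_1} × ⋯ × 𝒫_{μ_r}`. -/
def ParahoricProduct {n : ℕ} (γ : Gallery n) : Type :=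
  (j : Fin (γ.length + 1)) → parahoric (vertex γ j)

/-- The classical topology on `𝒫_{μ_0} × ⋯ × 𝒫_{μ_r}`, as a projective limit of complex varieties:
the coarsest topology for which all coefficients of all matrix entries are continuous functions
with values in `ℂ` (with its usual topology). -/
instance parahoricProductTopology {n : ℕ} (γ : Gallery n) :
    TopologicalSpace (ParahoricProduct γ) :=
  TopologicalSpace.induced
    (fun p (j : Fin (γ.length + 1)) (a b : Fin n) (k : ℤ) => ((p j : SL(n, 𝒦)) a b).coeff k)
    (inferInstance : TopologicalSpace (Fin (γ.length + 1) → Fin n → Fin n → ℤ → ℂ))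

/-- The orbit relation for
`(q_0, …, q_r) ∘ (p_0, …, p_r) = (p_0 q_0, q_0⁻¹ p_1 q_1, …, q_{r-1}⁻¹ p_r q_r)`, with
`q_j ∈ 𝒬_j` for `j < r` and `q_r ∈ 𝒫_{μ_r}`. -/
def BottSamelsonRel {n : ℕ} (γ : Gallery n) (p p' : ParahoricProduct γ) : Prop :=
  ∃ q : (j : Fin (γ.length + 1)) → segmentGroup γ j,
    (p' 0 : SL(n, 𝒦)) = p 0 * q 0 ∧
    ∀ j : Fin γ.length,
      (p' j.succ : SL(n, 𝒦)) = (q j.castSucc : SL(n, 𝒦))⁻¹ * p j.succ * q j.succ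

def bottSamelsonSetoid {n : ℕ} (γ : Gallery n) : Setoid (ParahoricProduct γ) where
  r := BottSamelsonRel γ
  iseqv :=
    { refl := fun p => ⟨fun _ => 1, by simp, fun j => by simp⟩
      symm := by
        rintro p p' ⟨q, h0, h⟩
        refine ⟨fun j => (q j)⁻¹, by rw [h0]; exact (mul_inv_cancel_right _ _).symm, fun j => ?_⟩
        rw [h j]
        simp [mul_assoc]
      trans := by
        rintro p p' p'' ⟨q, h0, h⟩ ⟨q', h0', h'⟩
        refine ⟨fun j => q j * q' j, by rw [h0', h0]; exact mul_assoc _ _ _, fun j => ?_⟩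
        rw [h' j, h j]
        simp [mul_assoc] }

/-- The Bott-Samelson variety
`Σ = 𝒫_{μ_0} ×_{𝒬_0} 𝒫_{μ_1} ×_{𝒬_1} ⋯ ×_{𝒬_{r-1}} 𝒫_{μ_r} / 𝒫_{μ_r}` with center `γ`, as the set
of complex points, endowed with the quotient topology, which is the classical topology of this
projective variety. -/
def BottSamelson {n : ℕ} (γ : Gallery n) : Type := Quotient (bottSamelsonSetoid γ)

/-- The class `[p_0, …, p_r]`. -/
def BottSamelson.mk {n : ℕ} {γ : Gallery n} (p : ParahoricProduct γ) : BottSamelson γ :=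
  Quotient.mk (bottSamelsonSetoid γ) p

instance bottSamelsonTopology {n : ℕ} (γ : Gallery n) : TopologicalSpace (BottSamelson γ) :=
  TopologicalSpace.coinduced BottSamelson.mk (parahoricProductTopology γ)

/-- The product `p_0 p_1 ⋯ p_{r-1}`. -/
def headProduct {n : ℕ} {γ : Gallery n} (p : ParahoricProduct γ) : SL(n, 𝒦) :=
  Fin.partialProd (fun j : Fin γ.length => (p j.castSucc : SL(n, 𝒦))) (Fin.last γ.length)

theorem loopAct_headProduct {n : ℕ} {γ : Gallery n} (p p' : ParahoricProduct γ)
    (hp : BottSamelsonRel γ p p') :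
    loopAct (headProduct p) (coweightPoint (vertex γ γ.length)) =
      loopAct (headProduct p') (coweightPoint (vertex γ γ.length)) := by
  obtain ⟨q, h0, h⟩ := hp
  have step : ∀ (m : ℕ) (hm : m < γ.length),
      Fin.partialProd (fun j : Fin γ.length => (p' j.castSucc : SL(n, 𝒦))) (Fin.succ ⟨m, hm⟩) =
      Fin.partialProd (fun j : Fin γ.length => (p j.castSucc : SL(n, 𝒦))) (Fin.succ ⟨m, hm⟩) *
        (q (Fin.castSucc ⟨m, hm⟩) : SL(n, 𝒦)) := by
    intro m
    induction m with
    | zero =>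
      intro hm
      rw [Fin.partialProd_succ, Fin.partialProd_succ]
      have e : Fin.castSucc (⟨0, hm⟩ : Fin γ.length) = 0 := rfl
      rw [e, Fin.partialProd_zero, Fin.partialProd_zero, one_mul, one_mul]
      exact h0
    | succ m ih =>
      intro hm
      have hm' : m < γ.length := by omega
      rw [Fin.partialProd_succ, Fin.partialProd_succ]
      have e : Fin.castSucc (⟨m + 1, hm⟩ : Fin γ.length) = Fin.succ ⟨m, hm'⟩ := rfl
      rw [e, ih hm', h ⟨m, hm'⟩]
      simp [mul_assoc]
  rcases Nat.eq_zero_or_pos γ.length with hr | hr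
  · have e : Fin.last γ.length = 0 := by ext; simp [hr]
    unfold headProduct
    rw [e, Fin.partialProd_zero, Fin.partialProd_zero]
  · obtain ⟨m, hm⟩ : ∃ m, γ.length = m + 1 := ⟨γ.length - 1, by omega⟩
    have hm' : m < γ.length := by omega
    have e : Fin.last γ.length = Fin.succ ⟨m, hm'⟩ := by ext; simp [hm]
    have hq : (q (Fin.castSucc ⟨m, hm'⟩) : SL(n, 𝒦)) ∈ parahoric (vertex γ γ.length) := by
      have hmem := (q (Fin.castSucc ⟨m, hm'⟩)).2
      simp only [segmentGroup, Fin.val_castSucc, if_pos hm'] at hmem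
      have e' : vertex γ γ.length = vertex γ (m + 1) := congrArg (vertex γ) hm
      rw [e']
      exact hmem.2
    have key : headProduct p' = headProduct p * (q (Fin.castSucc ⟨m, hm'⟩) : SL(n, 𝒦)) := by
      unfold headProduct
      rw [e]
      exact step m hm'
    have hfix := loopAct_coweightPoint _ _ hq
    rw [key]
    unfold loopAct at hfix ⊢
    rw [map_mul, mul_smul, hfix]

/-- The canonical map `π : Σ → G'(𝒦) / G'(𝒪)`, `[p_0, …, p_r] ↦ p_0 ⋯ p_{r-1} . μ_r`, the
desingularization of a Schubert variety. -/
def desingularization {n : ℕ} (γ : Gallery n) : BottSamelson γ → AffineGrassmannian n :=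
  Quotient.lift (fun p => loopAct (headProduct p) (coweightPoint (vertex γ γ.length)))
    (fun p p' hp => loopAct_headProduct p p' hp)

/-! ### The torus action and the cells -/

/-- A generic anti-dominant one parameter subgroup `s ↦ diag(s^{a_1}, …, s^{a_n})` of the diagonal
torus of `SL_n(ℂ)`: the exponents have sum `0` and `(α, a) < 0` for all positive roots
`α = ε_i - ε_j`, `i < j`. -/
structure AntidominantCocharacter (n : ℕ) where
  exponent : Fin n → ℤ
  sum_eq_zero : ∑ i, exponent i = 0
  antidominant : ∀ i j, i < j → exponent i - exponent j < 0

theorem prod_zpow_eq {n : ℕ} (a : Fin n → ℤ) (s : ℂˣ) : ∏ i, s ^ a i = s ^ ∑ i, a i := by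
  have h := map_sum (AddMonoidHom.mk' (fun k : ℤ => Additive.ofMul (s ^ k))
    fun x y => by rw [_root_.zpow_add]; rfl) a Finset.univ
  exact h.symm

/-- The element `η(s)`, as a constant loop. -/
def AntidominantCocharacter.eval {n : ℕ} (η : AntidominantCocharacter n) (s : ℂˣ) : SL(n, 𝒦) :=
  ⟨Matrix.diagonal fun a => HahnSeries.C ((s ^ η.exponent a : ℂˣ) : ℂ), by
    rw [Matrix.det_diagonal, ← map_prod, ← Units.coe_prod, prod_zpow_eq, η.sum_eq_zero, zpow_zero, Units.val_one, map_one]⟩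

theorem AntidominantCocharacter.eval_mem {n : ℕ} (η : AntidominantCocharacter n) (s : ℂˣ)
    (μ : Fin n → ℤ) : η.eval s ∈ parahoric μ := by
  intro a b k hk
  change (Matrix.diagonal (fun a => HahnSeries.C ((s ^ η.exponent a : ℂˣ) : ℂ)) a b).coeff k = 0
  by_cases hab : a = b
  · subst hab
    have hk0 : k ≠ 0 := by omega
    rw [Matrix.diagonal_apply_eq, HahnSeries.C_apply, HahnSeries.coeff_single_of_ne hk0]
  · simp [Matrix.diagonal_apply_ne _ hab]

/-- The action of `η(s)` on `𝒫_{μ_0} × ⋯ × 𝒫_{μ_r}`, by left multiplication on the first factor. -/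
def torusActProduct {n : ℕ} (η : AntidominantCocharacter n) (s : ℂˣ) {γ : Gallery n}
    (p : ParahoricProduct γ) : ParahoricProduct γ :=
  Function.update p 0 (⟨η.eval s, η.eval_mem s _⟩ * p 0)

/-- The action of `η(s)` on the Bott-Samelson variety:
`η(s) . [p_0, p_1, …, p_r] = [η(s) p_0, p_1, …, p_r]`. -/
def torusAct {n : ℕ} (η : AntidominantCocharacter n) (s : ℂˣ) {γ : Gallery n} :
    BottSamelson γ → BottSamelson γ :=
  Quotient.map' (s₁ := bottSamelsonSetoid γ) (s₂ := bottSamelsonSetoid γ) (torusActProduct η s) (by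
    rintro p p' ⟨q, h0, h⟩
    refine ⟨q, ?_, fun j => ?_⟩
    · have e : ∀ x : ParahoricProduct γ,
          torusActProduct η s x 0 = ⟨η.eval s, η.eval_mem s _⟩ * x 0 :=
        fun x => Function.update_self _ _ _
      rw [e, e, Subgroup.coe_mul, Subgroup.coe_mul, h0, mul_assoc]
    · have e : ∀ x : ParahoricProduct γ, torusActProduct η s x j.succ = x j.succ :=
        fun x => Function.update_of_ne (Fin.succ_ne_zero j) _ _
      rw [e, e]
      exact h j)

/-- The fixed point `[1, …, 1]` of the Bott-Samelson variety with center `γ`; it is the torus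
fixed point that corresponds to the gallery `γ`. -/
def galleryPoint {n : ℕ} (γ : Gallery n) : BottSamelson γ := BottSamelson.mk fun _ => 1

/-- The cell `C_γ = {x ∈ Σ | lim_{s → 0} η(s) . x = γ}`. -/
def cell {n : ℕ} (η : AntidominantCocharacter n) (γ : Gallery n) : Set (BottSamelson γ) :=
  {x | Tendsto (fun s : ℂˣ => torusAct η s x) (comap (fun s : ℂˣ => (s : ℂ)) (𝓝 0))
    (𝓝 (galleryPoint γ))}

/-- The image `Z_γ = π(C_γ)` of the cell in the affine Grassmannian. -/
def cellImage {n : ℕ} (η : AntidominantCocharacter n) (γ : Gallery n) :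
    Set (AffineGrassmannian n) :=
  desingularization γ '' cell η γ

end LoopGallery

end

noncomputable section
namespace LoopGallery
open Filter Topology
open scoped MatrixGroups Pointwise

variable {n : ℕ}

/-! ### Coefficients of products -/

/-! Write $U_\mu$ for the lower unitriangular elements of $\mathcal P_\mu$ (`lowerParahoric`). The
proof has a geometric and a combinatorial half.

Geometry (`cellImage_eq`): $Z_\gamma = U_{\mu_0}U_{\mu_1}\cdots U_{\mu_r}.\mu_r$. Modulo its
pro-unipotent radical, $\mathcal P_\mu$ acts on $\mathbb C^n$, and $\mathcal P_{\mu_j}/\mathcal Q_j$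
is a Grassmannian with a big cell around the base point. Splitting off big cell components one
factor after the other gives coordinates $u_0,\dots,u_{r-1}$ on an open neighbourhood of
$[1,\dots,1]$. They are continuous, independent of the representative, and conjugated by $\eta(s)$
under the torus action. Entry $(a,b)$ is thus scaled by $s^{a_a-a_b}$, an exponent that is negative
above the diagonal; convergence to $1$ forces these entries to vanish, so $u_j\in U_{\mu_j}$
(`inBigCells_and_coordinate_mem`). Conversely, conjugation by $\eta(s)$ contracts every $U_\mu$ to
$1$ as $s\to 0$ (`mk_mem_cell`).

Combinatorics (`gallerySet_eq_wordSet`): replacing a column by its letters, read one at a time,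
inserts intermediate vertices into the polyline. The corresponding extra factors are redundant: if
$\nu-\mu$ equals $\epsilon_i$ plus letters larger than $i$, then $U_{\mu+\epsilon_i}\subseteq U_\mu
U_\nu$, by splitting off the $i$-th row (`exists_factor_row`). The product of groups therefore
depends only on the word, and so does the end point $\mu_r$. -/

/-- The range of summation depends only on the lower bounds and not on the supports. Coefficients of
a product are therefore one fixed polynomial in the coefficients of the factors, which is what
continuity in families requires. -/
theorem coeff_mul_eq_sum {f g : 𝒦} {l m : ℤ} (hf : ∀ i < l, f.coeff i = 0)
    (hg : ∀ i < m, g.coeff i = 0) (k : ℤ) :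
    (f * g).coeff k = ∑ i ∈ Finset.Icc l (k - m), f.coeff i * g.coeff (k - i) := by
  rw [HahnSeries.coeff_mul]
  refine Finset.sum_of_injOn (fun ij => ij.1) ?_ ?_ ?_ ?_
  · intro x hx y hy hxy
    simp only [Finset.mem_coe, Finset.mem_antidiagonal] at hx hy
    ext
    · exact hxy
    · have := hx.2.2
      have := hy.2.2
      simp only at hxy
      omega
  · intro x hx
    simp only [Finset.mem_coe, Finset.mem_antidiagonal, HahnSeries.mem_support] at hx
    have h1 : l ≤ x.1 := by
      by_contra h
      exact hx.1 (hf _ (by omega))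
    have h2 : m ≤ x.2 := by
      by_contra h
      exact hx.2.1 (hg _ (by omega))
    simp only [Finset.coe_Icc, Set.mem_Icc]
    omega
  · intro i _ hi
    by_contra h
    refine hi ⟨(i, k - i), ?_, rfl⟩
    simp only [Finset.mem_coe, Finset.mem_antidiagonal, HahnSeries.mem_support]
    exact ⟨left_ne_zero_of_mul h, right_ne_zero_of_mul h, by omega⟩
  · intro x hx
    simp only [Finset.mem_antidiagonal] at hx
    rw [← hx.2.2, add_sub_cancel_left]


theorem coeff_mul_apply {μ : Fin n → ℤ} {g h : SL(n, 𝒦)} (hg : g ∈ parahoric μ)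
    (hh : h ∈ parahoric μ) (a b : Fin n) (k : ℤ) :
    ((g * h) a b).coeff k = ∑ c, ∑ i ∈ Finset.Icc (μ c - μ a) (k - (μ b - μ c)),
      (g a c).coeff i * (h c b).coeff (k - i) := by
  rw [Matrix.SpecialLinearGroup.coe_mul, Matrix.mul_apply, HahnSeries.coeff_sum]
  refine Finset.sum_congr rfl fun c _ => ?_
  exact coeff_mul_eq_sum (fun i hi => hg a c i (by omega)) (fun i hi => hh c b i (by omega)) k

theorem continuousOn_coeff_mul {X : Type*} [TopologicalSpace X] {O : Set X} {μ : Fin n → ℤ}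
    {F G : X → SL(n, 𝒦)} (hF : ∀ x ∈ O, F x ∈ parahoric μ) (hG : ∀ x ∈ O, G x ∈ parahoric μ)
    (cF : ∀ a b k, ContinuousOn (fun x => (F x a b).coeff k) O)
    (cG : ∀ a b k, ContinuousOn (fun x => (G x a b).coeff k) O) (a b : Fin n) (k : ℤ) :
    ContinuousOn (fun x => ((F x * G x) a b).coeff k) O := by
  refine ContinuousOn.congr ?_ fun x hx => coeff_mul_apply (hF x hx) (hG x hx) a b k
  exact continuousOn_finsetSum _ fun c _ => continuousOn_finsetSum _ fun i _ =>
    (cF a c i).mul (cG c b _)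

/-- The reduction of an element of `𝒫_μ` modulo its pro-unipotent radical. -/
def reduction (μ : Fin n → ℤ) (g : SL(n, 𝒦)) : Matrix (Fin n) (Fin n) ℂ :=
  Matrix.of fun a b => (g a b).coeff (μ b - μ a)

/-- In the lowest degree allowed at `μ` the interval of summation shrinks to a point, so that only
lowest coefficients of the factors contribute. -/
theorem reduction_mul {μ : Fin n → ℤ} {g h : SL(n, 𝒦)} (hg : g ∈ parahoric μ)
    (hh : h ∈ parahoric μ) : reduction μ (g * h) = reduction μ g * reduction μ h := by
  ext a b
  simp only [reduction, Matrix.of_apply, Matrix.mul_apply]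
  rw [coeff_mul_apply hg hh]
  refine Finset.sum_congr rfl fun c _ => ?_
  have e : μ b - μ a - (μ b - μ c) = μ c - μ a := by ring
  have e' : μ b - μ a - (μ c - μ a) = μ b - μ c := by ring
  rw [e, Finset.Icc_self, Finset.sum_singleton, e']

theorem reduction_one (μ : Fin n → ℤ) : reduction μ 1 = 1 := by
  ext a b
  by_cases h : a = b
  · subst h
    simp [reduction]
  · simp [reduction, Matrix.one_apply_ne h]

/-! ### The projection onto a coordinate subspace and the big cell of a Grassmannian -/

/-- The projection onto the coordinate subspace spanned by the basis vectors in `S`. -/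
def coordProj (S : Finset (Fin n)) : Matrix (Fin n) (Fin n) ℂ :=
  Matrix.diagonal fun a => if a ∈ S then 1 else 0

theorem coordProj_mul_self (S : Finset (Fin n)) : coordProj S * coordProj S = coordProj S := by
  simp [coordProj, Matrix.diagonal_mul_diagonal]

/-- The `S × S` block of a matrix, completed by an identity block. -/
def blockCompletion (S : Finset (Fin n)) (H : Matrix (Fin n) (Fin n) ℂ) :
    Matrix (Fin n) (Fin n) ℂ :=
  coordProj S * H * coordProj S + (1 - coordProj S)

/-- The coordinates, in the big cell, of the image under `H` of a coordinate subspace. -/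
def slope (S : Finset (Fin n)) (H : Matrix (Fin n) (Fin n) ℂ) : Matrix (Fin n) (Fin n) ℂ :=
  (1 - coordProj S) * H * coordProj S * (blockCompletion S H)⁻¹

theorem coordProj_mul_blockCompletion (S : Finset (Fin n)) (H : Matrix (Fin n) (Fin n) ℂ) :
    coordProj S * blockCompletion S H = coordProj S * H * coordProj S := by
  have h := coordProj_mul_self S
  simp only [blockCompletion, mul_add, mul_sub, mul_one, ← mul_assoc, h, sub_self, add_zero]

theorem blockCompletion_mul_coordProj (S : Finset (Fin n)) (H : Matrix (Fin n) (Fin n) ℂ) :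
    blockCompletion S H * coordProj S = coordProj S * H * coordProj S := by
  have h := coordProj_mul_self S
  simp only [blockCompletion, add_mul, sub_mul, one_mul, mul_assoc, h, sub_self, add_zero]

/-- The hypothesis says that `K` preserves the coordinate subspace of `S`; for such block triangular
`K` the diagonal blocks multiply. -/
theorem blockCompletion_mul {S : Finset (Fin n)} (H : Matrix (Fin n) (Fin n) ℂ)
    {K : Matrix (Fin n) (Fin n) ℂ} (hK : (1 - coordProj S) * K * coordProj S = 0) :
    blockCompletion S (H * K) = blockCompletion S H * blockCompletion S K := by
  have h := coordProj_mul_self S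
  have hK' : K * coordProj S = coordProj S * K * coordProj S := by
    rwa [sub_mul, sub_mul, one_mul, sub_eq_zero] at hK
  have e : blockCompletion S H * (1 - coordProj S) = 1 - coordProj S := by
    rw [mul_sub, mul_one, blockCompletion_mul_coordProj, blockCompletion, add_sub_cancel_left]
  conv_rhs => rw [blockCompletion.eq_1 S K]
  rw [mul_add, e, mul_assoc (coordProj S), ← mul_assoc, blockCompletion_mul_coordProj,
    blockCompletion]
  congr 1
  calc _ = coordProj S * H * (K * coordProj S) := by simp only [mul_assoc]
    _ = coordProj S * H * (coordProj S * K * coordProj S) := by rw [← hK']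
    _ = _ := by simp only [mul_assoc]

theorem blockCompletion_one (S : Finset (Fin n)) : blockCompletion S 1 = 1 := by
  simp [blockCompletion, coordProj_mul_self]

/-- The slope depends only on the image of the coordinate subspace under `H`, and `K` maps that
subspace onto itself. -/
theorem slope_mul {S : Finset (Fin n)} (H : Matrix (Fin n) (Fin n) ℂ)
    {K : Matrix (Fin n) (Fin n) ℂ} (hK : (1 - coordProj S) * K * coordProj S = 0)
    (hu : IsUnit (blockCompletion S K).det) : slope S (H * K) = slope S H := by
  have hK' : K * coordProj S = coordProj S * K * coordProj S := by
    rwa [sub_mul, sub_mul, one_mul, sub_eq_zero] at hK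
  have e : (1 - coordProj S) * (H * K) * coordProj S =
      (1 - coordProj S) * H * coordProj S * blockCompletion S K := by
    rw [mul_assoc _ (coordProj S), coordProj_mul_blockCompletion, ← hK']
    simp only [mul_assoc]
  rw [slope, e, blockCompletion_mul H hK, Matrix.mul_inv_rev, ← mul_assoc,
    Matrix.mul_nonsing_inv_cancel_right _ _ hu, slope]

theorem slope_eq_mul_mul {S : Finset (Fin n)} {H : Matrix (Fin n) (Fin n) ℂ}
    (hu : IsUnit (blockCompletion S H).det) :
    slope S H = (1 - coordProj S) * slope S H * coordProj S := by
  have h := coordProj_mul_self S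
  have hc : coordProj S * (blockCompletion S H)⁻¹ = (blockCompletion S H)⁻¹ * coordProj S := by
    have h1 : coordProj S * blockCompletion S H = blockCompletion S H * coordProj S := by
      rw [coordProj_mul_blockCompletion, blockCompletion_mul_coordProj]
    calc _ = (blockCompletion S H)⁻¹ * (blockCompletion S H * coordProj S) *
          (blockCompletion S H)⁻¹ := by rw [Matrix.nonsing_inv_mul_cancel_left _ _ hu]
      _ = _ := by rw [← h1, ← mul_assoc, Matrix.mul_nonsing_inv_cancel_right _ _ hu]
  have e : (1 - coordProj S) * (1 - coordProj S) = 1 - coordProj S := by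
    simp [mul_sub, sub_mul, h]
  have e2 : slope S H * coordProj S = slope S H := by
    rw [slope, mul_assoc, ← hc, ← mul_assoc, mul_assoc _ (coordProj S) (coordProj S), h]
  have e3 : (1 - coordProj S) * slope S H = slope S H := by
    simp only [slope, ← mul_assoc, e]
  rw [e3, e2]

/-- Block Gaussian elimination: the image of the coordinate subspace is the graph of the slope, and
the shear `1 - slope S H` moves it back to the coordinate subspace. -/
theorem one_sub_slope_mul {S : Finset (Fin n)} {H : Matrix (Fin n) (Fin n) ℂ}
    (hu : IsUnit (blockCompletion S H).det) :
    (1 - coordProj S) * ((1 - slope S H) * H) * coordProj S = 0 := by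
  have e3 : (1 - coordProj S) * slope S H = slope S H := by
    conv_rhs => rw [slope_eq_mul_mul hu]
    conv_lhs => rw [slope_eq_mul_mul hu]
    simp [← mul_assoc, mul_sub, sub_mul, coordProj_mul_self]
  have e2 : slope S H * coordProj S = slope S H := by
    conv_rhs => rw [slope_eq_mul_mul hu]
    conv_lhs => rw [slope_eq_mul_mul hu]
    rw [mul_assoc _ (coordProj S), coordProj_mul_self]
  have e4 : slope S H * H * coordProj S = (1 - coordProj S) * H * coordProj S := by
    calc _ = slope S H * (coordProj S * H * coordProj S) := by
          conv_lhs => rw [← e2]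
          simp only [mul_assoc]
      _ = slope S H * blockCompletion S H * coordProj S := by
          rw [← blockCompletion_mul_coordProj, mul_assoc]
      _ = _ := by
          rw [slope, Matrix.nonsing_inv_mul_cancel_right _ _ hu, mul_assoc, coordProj_mul_self]
  rw [← mul_assoc, mul_sub, mul_one, e3, sub_mul, sub_mul, e4, sub_self]

theorem blockCompletion_diagonal_mul (S : Finset (Fin n)) (d : Fin n → ℂ)
    (H : Matrix (Fin n) (Fin n) ℂ) : blockCompletion S (Matrix.diagonal d * H) =
      Matrix.diagonal (fun i => if i ∈ S then d i else 1) * blockCompletion S H := by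
  ext a b
  simp only [blockCompletion, coordProj, Matrix.add_apply, Matrix.sub_apply,
    Matrix.mul_diagonal, Matrix.diagonal_mul, Matrix.one_apply, Matrix.diagonal_apply]
  by_cases ha : a ∈ S <;> by_cases hab : a = b <;> simp [ha, hab] <;> simp_all

theorem det_blockCompletion_diagonal_mul_eq_zero (S : Finset (Fin n)) {d : Fin n → ℂ}
    (hd : ∀ i, d i ≠ 0) (H : Matrix (Fin n) (Fin n) ℂ) :
    (blockCompletion S (Matrix.diagonal d * H)).det = 0 ↔ (blockCompletion S H).det = 0 := by
  rw [blockCompletion_diagonal_mul, Matrix.det_mul, Matrix.det_diagonal, mul_eq_zero,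
    or_iff_right]
  refine Finset.prod_ne_zero_iff.2 fun i _ => ?_
  split_ifs
  exacts [hd i, one_ne_zero]

theorem slope_diagonal_mul {S : Finset (Fin n)} {d : Fin n → ℂ} (hd : ∀ i, d i ≠ 0)
    (H : Matrix (Fin n) (Fin n) ℂ) (a : Fin n) {b : Fin n} (hb : b ∈ S) :
    slope S (Matrix.diagonal d * H) a b = d a * (d b)⁻¹ * slope S H a b := by
  have hc : (1 - coordProj S) * Matrix.diagonal d = Matrix.diagonal d * (1 - coordProj S) := by
    simp [coordProj, sub_mul, mul_sub, Matrix.diagonal_mul_diagonal, mul_comm]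
  have e : slope S (Matrix.diagonal d * H) = Matrix.diagonal d * (slope S H *
      Matrix.diagonal fun i => if i ∈ S then (d i)⁻¹ else 1) := by
    have hi : (Matrix.diagonal fun i => if i ∈ S then d i else 1)⁻¹ =
        Matrix.diagonal fun i => if i ∈ S then (d i)⁻¹ else 1 := by
      apply Matrix.inv_eq_right_inv
      rw [Matrix.diagonal_mul_diagonal, ← Matrix.diagonal_one]
      congr 1
      ext i
      split_ifs
      · exact mul_inv_cancel₀ (hd i)
      · exact one_mul 1
    rw [slope, blockCompletion_diagonal_mul, Matrix.mul_inv_rev, hi, ← mul_assoc _ _ H, hc, slope]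
    simp only [mul_assoc]
  rw [e, Matrix.diagonal_mul, Matrix.mul_diagonal, if_pos hb]
  ring

theorem coordProj_compl_mul_mul_apply (S : Finset (Fin n)) (X : Matrix (Fin n) (Fin n) ℂ)
    (a b : Fin n) : ((1 - coordProj S) * X * coordProj S) a b =
      if a ∉ S ∧ b ∈ S then X a b else 0 := by
  have e : 1 - coordProj S = Matrix.diagonal fun a => if a ∈ S then (0 : ℂ) else 1 := by
    rw [coordProj, ← Matrix.diagonal_one, Matrix.diagonal_sub]
    congr 1
    ext i
    split_ifs <;> simp
  rw [e, coordProj, Matrix.mul_diagonal, Matrix.diagonal_mul]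
  by_cases ha : a ∈ S <;> by_cases hb : b ∈ S <;> simp [ha, hb]

/-- Passing from `μ` to `ν` strengthens the condition only for rows outside `S` and columns in `S`,
and there by exactly one coefficient, the one recorded by the reduction. The group of a segment is
thus the preimage of the stabilizer of a coordinate subspace. -/
theorem mem_parahoric_inf_iff {μ ν : Fin n → ℤ} {S : Finset (Fin n)}
    (hν : ∀ a, ν a = μ a + if a ∈ S then 1 else 0) {g : SL(n, 𝒦)} :
    g ∈ parahoric μ ⊓ parahoric ν ↔
      g ∈ parahoric μ ∧ (1 - coordProj S) * reduction μ g * coordProj S = 0 := by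
  rw [Subgroup.mem_inf]
  refine and_congr_right fun hg => ⟨fun h => ?_, fun h a b k hk => ?_⟩
  · ext a b
    rw [coordProj_compl_mul_mul_apply]
    split_ifs with hab
    · refine h a b _ ?_
      rw [hν, hν, if_neg hab.1, if_pos hab.2]
      omega
    · rfl
  · by_cases hk' : μ a - μ b + k < 0
    · exact hg a b k hk'
    rw [hν, hν] at hk
    have hab : a ∉ S ∧ b ∈ S := by
      by_cases ha : a ∈ S <;> by_cases hb : b ∈ S <;> simp only [ha, hb, if_true, if_false] at hk
      · omega
      · omega
      · exact ⟨ha, hb⟩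
      · omega
    rw [if_neg hab.1, if_pos hab.2] at hk
    have h1 := congrFun (congrFun h a) b
    rw [coordProj_compl_mul_mul_apply, if_pos hab] at h1
    have hk1 : k = μ b - μ a := by omega
    rw [hk1]
    exact h1

/-- Sylvester's identity $\det(1+MP)=\det(1+PM)$. With a coordinate projection as `P` it serves both
the opposite root subgroups and the single-row matrices of `exists_factor_row`. -/
theorem det_one_add_eq_one {R : Type*} [CommRing R] {M P : Matrix (Fin n) (Fin n) R}
    (h : M * P = M) (h' : P * M = 0) : (1 + M).det = 1 := by
  rw [← h, Matrix.det_one_add_mul_comm, h', add_zero, Matrix.det_one]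

/-! ### The root subgroups opposite to a segment -/

/-- The off-diagonal block of the matrix `t^{-μ} X t^{μ}` with rows outside `S` and columns
in `S`. -/
def offBlock (μ : Fin n → ℤ) (S : Finset (Fin n)) (X : Matrix (Fin n) (Fin n) ℂ) :
    Matrix (Fin n) (Fin n) 𝒦 :=
  Matrix.of fun a b => if a ∉ S ∧ b ∈ S then HahnSeries.single (μ b - μ a) (X a b) else 0

theorem offBlock_mul_offBlock (μ : Fin n → ℤ) (S : Finset (Fin n))
    (X Y : Matrix (Fin n) (Fin n) ℂ) : offBlock μ S X * offBlock μ S Y = 0 := by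
  ext a b : 1
  rw [Matrix.mul_apply]
  refine Finset.sum_eq_zero fun c _ => ?_
  by_cases hc : c ∈ S <;> simp [offBlock, hc]

/-- The element `1 + t^{-μ} X t^{μ}`, for `X` in the off-diagonal block attached to `S`. -/
def oppositeElement (μ : Fin n → ℤ) (S : Finset (Fin n)) (X : Matrix (Fin n) (Fin n) ℂ) :
    SL(n, 𝒦) :=
  ⟨1 + offBlock μ S X, by
    refine det_one_add_eq_one (P := Matrix.diagonal fun a => if a ∈ S then 1 else 0) ?_ ?_
    · ext a b : 1
      by_cases hb : b ∈ S <;> simp [offBlock, hb]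
    · ext a b : 1
      by_cases ha : a ∈ S <;> simp [offBlock, ha]⟩

theorem coe_oppositeElement (μ : Fin n → ℤ) (S : Finset (Fin n))
    (X : Matrix (Fin n) (Fin n) ℂ) :
    (oppositeElement μ S X : Matrix (Fin n) (Fin n) 𝒦) = 1 + offBlock μ S X := rfl

theorem inv_oppositeElement (μ : Fin n → ℤ) (S : Finset (Fin n))
    (X : Matrix (Fin n) (Fin n) ℂ) : (oppositeElement μ S X)⁻¹ = oppositeElement μ S (-X) := by
  rw [inv_eq_iff_mul_eq_one]
  apply Subtype.ext
  rw [Matrix.SpecialLinearGroup.coe_mul, coe_oppositeElement, coe_oppositeElement, mul_add,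
    add_mul, add_mul, offBlock_mul_offBlock, Matrix.SpecialLinearGroup.coe_one]
  have : offBlock μ S X + offBlock μ S (-X) = 0 := by
    ext a b : 1
    by_cases h : a ∉ S ∧ b ∈ S <;> simp [offBlock, h]
  simp only [mul_one, one_mul, add_zero, add_assoc, this]

theorem coeff_oppositeElement (μ : Fin n → ℤ) (S : Finset (Fin n))
    (X : Matrix (Fin n) (Fin n) ℂ) (a b : Fin n) (k : ℤ) :
    (oppositeElement μ S X a b).coeff k = (if a = b ∧ k = 0 then 1 else 0) +
      if (a ∉ S ∧ b ∈ S) ∧ k = μ b - μ a then X a b else 0 := by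
  change ((1 + offBlock μ S X : Matrix (Fin n) (Fin n) 𝒦) a b).coeff k = _
  rw [Matrix.add_apply, HahnSeries.coeff_add]
  congr 1
  · by_cases hab : a = b
    · subst hab
      simp [HahnSeries.coeff_one]
    · simp [hab]
  · by_cases h : a ∉ S ∧ b ∈ S
    · simp [offBlock, h, HahnSeries.coeff_single]
    · simp only [offBlock, Matrix.of_apply, h, false_and, if_false, HahnSeries.coeff_zero]

theorem oppositeElement_mem (μ : Fin n → ℤ) (S : Finset (Fin n))
    (X : Matrix (Fin n) (Fin n) ℂ) : oppositeElement μ S X ∈ parahoric μ := by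
  intro a b k hk
  rw [coeff_oppositeElement, if_neg, if_neg, add_zero]
  · omega
  · rintro ⟨rfl, rfl⟩
    omega

theorem reduction_oppositeElement (μ : Fin n → ℤ) (S : Finset (Fin n))
    (X : Matrix (Fin n) (Fin n) ℂ) :
    reduction μ (oppositeElement μ S X) = 1 + (1 - coordProj S) * X * coordProj S := by
  ext a b
  rw [reduction, Matrix.of_apply, coeff_oppositeElement, Matrix.add_apply,
    coordProj_compl_mul_mul_apply, Matrix.one_apply]
  congr 1
  · refine if_congr ?_ rfl rfl
    exact and_iff_left_of_imp fun h => by rw [h, sub_self]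
  · simp

/-! ### The decomposition of an element of a parahoric subgroup in the big cell -/

/-- The component in the opposite root subgroups of an element in the big cell of `𝒫_μ`. -/
def bigCellPart (μ : Fin n → ℤ) (S : Finset (Fin n)) (g : SL(n, 𝒦)) : SL(n, 𝒦) :=
  oppositeElement μ S (slope S (reduction μ g))

/-- The condition that an element of `𝒫_μ` belongs to the big cell. -/
def InBigCell (μ : Fin n → ℤ) (S : Finset (Fin n)) (g : SL(n, 𝒦)) : Prop :=
  (blockCompletion S (reduction μ g)).det ≠ 0

variable {μ ν : Fin n → ℤ} {S : Finset (Fin n)}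

theorem inBigCell_one : InBigCell μ S 1 := by
  rw [InBigCell, reduction_one, blockCompletion_one, Matrix.det_one]
  exact one_ne_zero

theorem bigCellPart_inv_mul_mem (hν : ∀ a, ν a = μ a + if a ∈ S then 1 else 0) {g : SL(n, 𝒦)}
    (hg : g ∈ parahoric μ) (hc : InBigCell μ S g) :
    (bigCellPart μ S g)⁻¹ * g ∈ parahoric μ ⊓ parahoric ν := by
  have hu : IsUnit (blockCompletion S (reduction μ g)).det := isUnit_iff_ne_zero.2 hc
  have hm : oppositeElement μ S (-slope S (reduction μ g)) ∈ parahoric μ :=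
    oppositeElement_mem _ _ _
  rw [bigCellPart, inv_oppositeElement, mem_parahoric_inf_iff hν]
  refine ⟨mul_mem hm hg, ?_⟩
  rw [reduction_mul hm hg, reduction_oppositeElement]
  have e : 1 + (1 - coordProj S) * -slope S (reduction μ g) * coordProj S =
      1 - slope S (reduction μ g) := by
    conv_rhs => rw [slope_eq_mul_mul hu]
    rw [mul_neg, neg_mul, ← sub_eq_add_neg]
  rw [e]
  exact one_sub_slope_mul hu

theorem blockCompletion_reduction_mul (hν : ∀ a, ν a = μ a + if a ∈ S then 1 else 0)
    {g q : SL(n, 𝒦)} (hg : g ∈ parahoric μ) (hq : q ∈ parahoric μ ⊓ parahoric ν) :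
    blockCompletion S (reduction μ (g * q)) =
      blockCompletion S (reduction μ g) * blockCompletion S (reduction μ q) := by
  have h := (mem_parahoric_inf_iff hν).1 hq
  rw [reduction_mul hg h.1, blockCompletion_mul _ h.2]

/-- The block is multiplicative on the group of the segment, so the block of `q⁻¹` inverts the block
of `q`. -/
theorem inBigCell_of_mem (hν : ∀ a, ν a = μ a + if a ∈ S then 1 else 0) {q : SL(n, 𝒦)}
    (hq : q ∈ parahoric μ ⊓ parahoric ν) : InBigCell μ S q := by
  have h := blockCompletion_reduction_mul hν hq.1 (inv_mem hq)
  rw [mul_inv_cancel, reduction_one, blockCompletion_one] at h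
  have h' := congrArg Matrix.det h
  rw [Matrix.det_one, Matrix.det_mul] at h'
  exact left_ne_zero_of_mul (h' ▸ one_ne_zero)

theorem inBigCell_mul (hν : ∀ a, ν a = μ a + if a ∈ S then 1 else 0) {g q : SL(n, 𝒦)}
    (hg : g ∈ parahoric μ) (hq : q ∈ parahoric μ ⊓ parahoric ν) (hc : InBigCell μ S g) :
    InBigCell μ S (g * q) := by
  rw [InBigCell, blockCompletion_reduction_mul hν hg hq, Matrix.det_mul]
  exact mul_ne_zero hc (inBigCell_of_mem hν hq)

theorem slope_reduction_mul (hν : ∀ a, ν a = μ a + if a ∈ S then 1 else 0) {g q : SL(n, 𝒦)}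
    (hg : g ∈ parahoric μ) (hq : q ∈ parahoric μ ⊓ parahoric ν) :
    slope S (reduction μ (g * q)) = slope S (reduction μ g) := by
  have h := (mem_parahoric_inf_iff hν).1 hq
  rw [reduction_mul hg h.1, slope_mul _ h.2 (isUnit_iff_ne_zero.2 (inBigCell_of_mem hν hq))]

theorem bigCellPart_mul (hν : ∀ a, ν a = μ a + if a ∈ S then 1 else 0) {g q : SL(n, 𝒦)}
    (hg : g ∈ parahoric μ) (hq : q ∈ parahoric μ ⊓ parahoric ν) :
    bigCellPart μ S (g * q) = bigCellPart μ S g := by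
  rw [bigCellPart, slope_reduction_mul hν hg hq, bigCellPart]

/-! ### Lower unitriangular elements -/

/-- The group of elements of `𝒫_μ` that are lower unitriangular. -/
def lowerParahoric (μ : Fin n → ℤ) : Submonoid SL(n, 𝒦) where
  carrier := {g | g ∈ parahoric μ ∧ ∀ a b, a ≤ b → g a b = if a = b then 1 else 0}
  one_mem' := ⟨one_mem _, fun a b _ => by simp [Matrix.one_apply]⟩
  mul_mem' := by
    rintro g h ⟨hg, hg'⟩ ⟨hh, hh'⟩
    refine ⟨mul_mem hg hh, fun a b hab => ?_⟩
    rw [Matrix.SpecialLinearGroup.coe_mul, Matrix.mul_apply, Finset.sum_eq_single a]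
    · rw [hg' a a le_rfl, if_pos rfl, one_mul, hh' a b hab]
    · intro c _ hc
      rcases lt_or_gt_of_ne hc with h1 | h1
      · rw [hh' c b (h1.le.trans hab), if_neg (h1.trans_le hab).ne, mul_zero]
      · rw [hg' a c h1.le, if_neg h1.ne, zero_mul]
    · simp

/-- `y` carries the `i`-th row of `g`, and `x` is what remains. The entries of that row lie in
columns `b < i`, where `ν` and `μ + Pi.single i 1` impose the same condition; on the other rows, `μ`
asks no more than `μ + Pi.single i 1` does. -/
theorem exists_factor_row {μ ν : Fin n → ℤ} {i : Fin n} (hi : ν i = μ i + 1)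
    (hlt : ∀ a < i, ν a = μ a)
    {g : SL(n, 𝒦)} (hg : g ∈ lowerParahoric (μ + Pi.single i 1)) :
    ∃ x ∈ lowerParahoric μ, ∃ y ∈ lowerParahoric ν, g = x * y := by
  obtain ⟨hp, hl⟩ := hg
  let R (f : Fin n → 𝒦) : Matrix (Fin n) (Fin n) 𝒦 :=
    Matrix.of fun a b => if a = i ∧ b < i then f b else 0
  have hRR : ∀ f f', R f * R f' = 0 := by
    intro f f'
    ext a b : 1
    rw [Matrix.mul_apply]
    refine Finset.sum_eq_zero fun c _ => ?_
    simp only [R, Matrix.of_apply]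
    by_cases h : c = i <;> simp [h]
  have hRneg : ∀ f, R (-f) + R f = 0 := by
    intro f
    ext a b : 1
    by_cases h : a = i ∧ b < i <;> simp [R, h]
  have hone : ∀ f a b, a ≤ b → (1 + R f) a b = if a = b then 1 else 0 := by
    intro f a b hab
    have h0 : R f a b = 0 := by
      simp only [R, Matrix.of_apply]
      rw [if_neg]
      rintro ⟨rfl, h⟩
      exact absurd h (not_lt.2 hab)
    rw [Matrix.add_apply, h0, add_zero, Matrix.one_apply]
  have hdet : ∀ f, (1 + R f).det = 1 := by
    intro f
    refine det_one_add_eq_one (P := Matrix.diagonal fun b => if b < i then 1 else 0) ?_ ?_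
    · ext a b : 1
      by_cases hb : b < i <;> simp [R, hb]
    · ext a b : 1
      by_cases ha : a = i <;> simp [R, ha]
  let y : SL(n, 𝒦) := ⟨1 + R (g i), hdet _⟩
  let z : SL(n, 𝒦) := ⟨1 + R (-g i), hdet _⟩
  have hzy : z * y = 1 := by
    apply Subtype.ext
    change (1 + R (-g i)) * (1 + R (g i)) = 1
    rw [mul_add, add_mul, add_mul, hRR, mul_one, mul_one, one_mul, add_zero, add_assoc, hRneg,
      add_zero]
  -- Stated for a general `ρ` because it is needed twice: at `μ + Pi.single i 1`, to keep `g * z` in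
  -- that group, and at `ν`.
  have hy : ∀ ρ : Fin n → ℤ, (∀ b < i, ρ i - ρ b = μ i + 1 - μ b) → y ∈ parahoric ρ := by
    intro ρ hρ a b k hk
    change ((1 + R (g i)) a b).coeff k = 0
    rw [Matrix.add_apply, HahnSeries.coeff_add]
    have h1 : ((1 : Matrix (Fin n) (Fin n) 𝒦) a b).coeff k = 0 := one_mem (parahoric ρ) a b k hk
    rw [h1, zero_add]
    simp only [R, Matrix.of_apply]
    split_ifs with h
    · obtain ⟨rfl, hb⟩ := h
      refine hp a b k ?_
      rw [hρ b hb] at hk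
      simp only [Pi.add_apply, Pi.single_eq_same, Pi.single_eq_of_ne hb.ne]
      omega
    · rfl
  have hy1 : y ∈ lowerParahoric (μ + Pi.single i 1) :=
    ⟨hy _ fun b hb => by simp [hb.ne], hone _⟩
  have hz1 : z ∈ lowerParahoric (μ + Pi.single i 1) := by
    refine ⟨?_, hone _⟩
    rw [eq_inv_of_mul_eq_one_left hzy]
    exact inv_mem hy1.1
  have hx1 : g * z ∈ lowerParahoric (μ + Pi.single i 1) := mul_mem ⟨hp, hl⟩ hz1
  -- Since the diagonal entry of `g` at `i` is `1`, multiplication by `z` subtracts from row `i`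
  -- exactly its entries left of the diagonal.
  have hrow : ∀ b, b ≠ i → (g * z) i b = 0 := by
    intro b hb
    rw [Matrix.SpecialLinearGroup.coe_mul]
    change (g.1 * (1 + R (-g i))) i b = 0
    rw [mul_add, mul_one, Matrix.add_apply, Matrix.mul_apply, Finset.sum_eq_single i]
    · have hii : g.1 i i = 1 := by
        rw [hl i i le_rfl, if_pos rfl]
      rw [hii, one_mul]
      simp only [R, Matrix.of_apply, true_and]
      rcases lt_or_gt_of_ne hb with h | h
      · rw [if_pos h]
        exact add_neg_cancel _
      · rw [hl i b h.le, if_neg h.ne, if_neg (not_lt.2 h.le), add_zero]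
    · intro c _ hc
      simp [R, hc]
    · simp
  refine ⟨g * z, ⟨fun a b k hk => ?_, hx1.2⟩, y, ⟨hy ν fun b hb => ?_, hone _⟩, ?_⟩
  · by_cases hab : a = b
    · subst hab
      exact hx1.1 a a k (by omega)
    by_cases ha : a = i
    · subst ha
      rw [hrow b (Ne.symm hab), HahnSeries.coeff_zero]
    · refine hx1.1 a b k ?_
      have h0 : (0 : ℤ) ≤ (Pi.single i 1 : Fin n → ℤ) b := by
        by_cases hb : b = i
        · subst hb
          simp
        · simp [hb]
      simp only [Pi.add_apply, Pi.single_eq_of_ne ha]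
      omega
  · rw [hi, hlt b hb]
  · rw [mul_assoc, hzy, mul_one]

/-! ### Products of lower unitriangular groups along a word and along a gallery -/

/-- The coweight of a word. -/
def wordCoweight (w : List (Fin n)) : Fin n → ℤ := (w.map fun i => Pi.single i 1).sum

theorem wordCoweight_cons (i : Fin n) (w : List (Fin n)) :
    wordCoweight (i :: w) = Pi.single i 1 + wordCoweight w := by
  simp [wordCoweight]

theorem wordCoweight_append (v w : List (Fin n)) :
    wordCoweight (v ++ w) = wordCoweight v + wordCoweight w := by
  simp [wordCoweight]

theorem wordCoweight_apply {w : List (Fin n)} (hw : w.Nodup) (a : Fin n) :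
    wordCoweight w a = if a ∈ w then 1 else 0 := by
  induction w with
  | nil => simp [wordCoweight]
  | cons i w ih =>
    rw [List.nodup_cons] at hw
    rw [wordCoweight_cons, Pi.add_apply, ih hw.2]
    by_cases h : a = i
    · subst h
      simp [hw.1]
    · simp [h]

theorem wordCoweight_column (c : Column n) : wordCoweight c.1 = columnCoweight c :=
  funext fun a => wordCoweight_apply (c.2.2.imp fun h => h.ne) a

theorem Gallery.word_cons (c : Column n) (γ : Gallery n) :
    Gallery.word (c :: γ) = c.1 ++ Gallery.word γ := rfl

theorem vertex_zero (γ : Gallery n) : vertex γ 0 = 0 := by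
  simp [vertex]

theorem vertex_cons_succ (c : Column n) (γ : Gallery n) (j : ℕ) :
    vertex (c :: γ) (j + 1) = columnCoweight c + vertex γ j := by
  simp [vertex]

theorem vertex_length (γ : Gallery n) : vertex γ γ.length = wordCoweight γ.word := by
  induction γ with
  | nil => rfl
  | cons c γ ih =>
    rw [List.length_cons, vertex_cons_succ, ih, Gallery.word_cons, wordCoweight_append,
      wordCoweight_column]

/-- The product of the lower unitriangular groups at the vertices of the polyline that starts
at `μ` and follows the letters of a word. -/
def wordSet (μ : Fin n → ℤ) : List (Fin n) → Set SL(n, 𝒦)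
  | [] => lowerParahoric μ
  | i :: w => (lowerParahoric μ : Set SL(n, 𝒦)) * wordSet (μ + Pi.single i 1) w

/-- The product of the lower unitriangular groups at the vertices of the polyline that starts
at `μ` and follows the columns of a gallery. -/
def gallerySet (μ : Fin n → ℤ) : Gallery n → Set SL(n, 𝒦)
  | [] => lowerParahoric μ
  | c :: γ => lowerParahoric μ * gallerySet (μ + columnCoweight c) γ

theorem lowerParahoric_mul_wordSet (μ : Fin n → ℤ) (w : List (Fin n)) :
    (lowerParahoric μ : Set SL(n, 𝒦)) * wordSet μ w = wordSet μ w := by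
  cases w with
  | nil => exact Submonoid.coe_mul_self_eq _
  | cons i w => rw [wordSet, ← mul_assoc, Submonoid.coe_mul_self_eq]

/-- The middle factor can be dropped: its elements split into a part absorbed on the left and a part
absorbed on the right. -/
theorem lowerParahoric_mul_mul {μ ν : Fin n → ℤ} {i : Fin n} (hi : ν i = μ i + 1)
    (hlt : ∀ a < i, ν a = μ a) :
    (lowerParahoric μ : Set SL(n, 𝒦)) * ((lowerParahoric (μ + Pi.single i 1) : Set SL(n, 𝒦)) *
      (lowerParahoric ν : Set SL(n, 𝒦))) =
      (lowerParahoric μ : Set SL(n, 𝒦)) * (lowerParahoric ν : Set SL(n, 𝒦)) := by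
  apply Set.Subset.antisymm
  · rintro _ ⟨g, hg, _, ⟨h, hh, k, hk, rfl⟩, rfl⟩
    obtain ⟨x, hx, y, hy, rfl⟩ := exists_factor_row hi hlt hh
    exact ⟨g * x, mul_mem hg hx, y * k, mul_mem hy hk, by simp only [mul_assoc]⟩
  · rintro _ ⟨g, hg, k, hk, rfl⟩
    exact ⟨g, hg, _, ⟨1, one_mem _, k, hk, rfl⟩, by simp only [one_mul]⟩

/-- Because `v` is strictly increasing, the letters after `i` leave the coordinates `≤ i` unchanged.
This is exactly what is needed to remove the vertex reached after the letter `i`. -/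
theorem wordSet_append {v : List (Fin n)} (hv : v.Pairwise (· < ·)) (μ : Fin n → ℤ)
    (w : List (Fin n)) :
    wordSet μ (v ++ w) = (lowerParahoric μ : Set SL(n, 𝒦)) * wordSet (μ + wordCoweight v) w := by
  induction v generalizing μ with
  | nil => simp [wordCoweight, lowerParahoric_mul_wordSet]
  | cons i v ih =>
    rw [List.pairwise_cons] at hv
    have h0 : ∀ a ≤ i, wordCoweight v a = 0 := fun a ha => by
      rw [wordCoweight_apply (hv.2.imp fun h => h.ne), if_neg]
      exact fun h => absurd (hv.1 a h) (not_lt.2 ha)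
    rw [List.cons_append, wordSet, ih hv.2, wordCoweight_cons, ← add_assoc,
      ← lowerParahoric_mul_wordSet (μ + Pi.single i 1 + wordCoweight v), ← mul_assoc, ← mul_assoc,
      mul_assoc (lowerParahoric μ : Set SL(n, 𝒦)), lowerParahoric_mul_mul, mul_assoc]
    · simp [h0 i le_rfl]
    · intro a ha
      simp [h0 a ha.le, ha.ne]

theorem gallerySet_eq_wordSet (μ : Fin n → ℤ) (γ : Gallery n) :
    gallerySet μ γ = wordSet μ γ.word := by
  induction γ generalizing μ with
  | nil => rfl
  | cons c γ ih =>
    rw [gallerySet, ih, Gallery.word_cons, wordSet_append c.2.2, wordCoweight_column]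

theorem mem_gallerySet {μ : Fin n → ℤ} {γ : Gallery n} {g : SL(n, 𝒦)} :
    g ∈ gallerySet μ γ ↔ ∃ u : ℕ → SL(n, 𝒦), (∀ j, u j ∈ lowerParahoric (μ + vertex γ j)) ∧
      g = ((List.range (γ.length + 1)).map u).prod := by
  induction γ generalizing μ g with
  | nil =>
    simp only [gallerySet, SetLike.mem_coe]
    constructor
    · intro hg
      exact ⟨fun _ => g, fun j => by simpa [vertex] using hg, by simp⟩
    · rintro ⟨u, hu, rfl⟩
      simpa [vertex] using hu 0
  | cons c γ ih =>
    rw [gallerySet, Set.mem_mul]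
    constructor
    · rintro ⟨x, hx, y, hy, rfl⟩
      obtain ⟨u, hu, rfl⟩ := ih.1 hy
      refine ⟨fun j => j.casesOn x u, fun j => ?_, ?_⟩
      · cases j with
        | zero => simpa [vertex_zero] using hx
        | succ j => simpa [vertex_cons_succ, add_assoc] using hu j
      · rw [List.length_cons, List.prod_range_succ' _ (γ.length + 1)]
        rfl
    · rintro ⟨u, hu, rfl⟩
      refine ⟨u 0, by simpa [vertex_zero] using hu 0, _, ih.2 ⟨fun j => u (j + 1), fun j => ?_, rfl⟩,
        ?_⟩
      · simpa [vertex_cons_succ, add_assoc] using hu (j + 1)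
      · rw [List.length_cons, List.prod_range_succ' _ (γ.length + 1)]

/-! ### The action of the one parameter subgroup on coefficients -/

/-- The diagonal entries of `η(s)`. -/
def AntidominantCocharacter.diag (η : AntidominantCocharacter n) (s : ℂˣ) (a : Fin n) : ℂ :=
  ((s ^ η.exponent a : ℂˣ) : ℂ)

theorem AntidominantCocharacter.diag_ne_zero (η : AntidominantCocharacter n) (s : ℂˣ)
    (a : Fin n) : η.diag s a ≠ 0 :=
  Units.ne_zero _

theorem AntidominantCocharacter.diag_mul_inv (η : AntidominantCocharacter n) (s : ℂˣ)
    (a b : Fin n) :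
    η.diag s a * (η.diag s b)⁻¹ = (s : ℂ) ^ (η.exponent a - η.exponent b) := by
  rw [diag, diag, Units.val_zpow_eq_zpow_val, Units.val_zpow_eq_zpow_val, zpow_sub₀ s.ne_zero,
    div_eq_mul_inv]

theorem coeff_eval_mul (η : AntidominantCocharacter n) (s : ℂˣ) (g : SL(n, 𝒦)) (a b : Fin n)
    (k : ℤ) : ((η.eval s * g) a b).coeff k = η.diag s a * (g a b).coeff k := by
  rw [Matrix.SpecialLinearGroup.coe_mul]
  change (((Matrix.diagonal fun a => HahnSeries.C (η.diag s a) : Matrix (Fin n) (Fin n) 𝒦) * g.1)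
    a b).coeff k = _
  rw [Matrix.diagonal_mul, HahnSeries.C_mul_eq_smul, HahnSeries.coeff_smul, smul_eq_mul]

theorem coeff_mul_eval (η : AntidominantCocharacter n) (s : ℂˣ) (g : SL(n, 𝒦)) (a b : Fin n)
    (k : ℤ) : ((g * η.eval s) a b).coeff k = (g a b).coeff k * η.diag s b := by
  rw [Matrix.SpecialLinearGroup.coe_mul]
  change ((g.1 * (Matrix.diagonal fun a => HahnSeries.C (η.diag s a) : Matrix (Fin n) (Fin n) 𝒦))
    a b).coeff k = _
  rw [Matrix.mul_diagonal, mul_comm, HahnSeries.C_mul_eq_smul, HahnSeries.coeff_smul, smul_eq_mul,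
    mul_comm]

theorem coeff_eval_conj (η : AntidominantCocharacter n) (s : ℂˣ) (g : SL(n, 𝒦)) (a b : Fin n)
    (k : ℤ) : ((η.eval s * g * (η.eval s)⁻¹) a b).coeff k =
      (s : ℂ) ^ (η.exponent a - η.exponent b) * (g a b).coeff k := by
  have h := coeff_mul_eval η s (η.eval s * g * (η.eval s)⁻¹) a b k
  rw [inv_mul_cancel_right, coeff_eval_mul] at h
  rw [← η.diag_mul_inv, mul_right_comm, h, mul_inv_cancel_right₀ (η.diag_ne_zero s b)]

theorem specialLinear_ext_coeff {g h : SL(n, 𝒦)} (H : ∀ a b k, (g a b).coeff k = (h a b).coeff k) :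
    g = h := by
  apply Subtype.ext
  ext a b k
  exact H a b k

theorem reduction_eval_mul (η : AntidominantCocharacter n) (s : ℂˣ) (μ : Fin n → ℤ)
    (g : SL(n, 𝒦)) :
    reduction μ (η.eval s * g) = Matrix.diagonal (η.diag s) * reduction μ g := by
  ext a b
  rw [Matrix.diagonal_mul]
  exact coeff_eval_mul η s g a b _

theorem inBigCell_eval_mul (η : AntidominantCocharacter n) (s : ℂˣ) {μ : Fin n → ℤ}
    {S : Finset (Fin n)} {g : SL(n, 𝒦)} : InBigCell μ S (η.eval s * g) ↔ InBigCell μ S g := by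
  rw [InBigCell, reduction_eval_mul]
  exact not_congr (det_blockCompletion_diagonal_mul_eq_zero S (η.diag_ne_zero s) _)

theorem bigCellPart_eval_mul (η : AntidominantCocharacter n) (s : ℂˣ) (μ : Fin n → ℤ)
    (S : Finset (Fin n)) (g : SL(n, 𝒦)) :
    bigCellPart μ S (η.eval s * g) = η.eval s * bigCellPart μ S g * (η.eval s)⁻¹ := by
  refine specialLinear_ext_coeff fun a b k => ?_
  rw [coeff_eval_conj, bigCellPart, bigCellPart, coeff_oppositeElement, coeff_oppositeElement,
    mul_add, reduction_eval_mul]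
  congr 1
  · split_ifs with h
    · rw [h.1, sub_self, zpow_zero, one_mul]
    · rw [mul_zero]
  · split_ifs with h
    · rw [slope_diagonal_mul (η.diag_ne_zero s) _ _ h.1.2, η.diag_mul_inv]
    · rw [mul_zero]

/-! ### Coordinates in the big cell of a Bott-Samelson variety -/

/-- The set of letters of the `j`-th column of a gallery. -/
def columnSupport (γ : Gallery n) (j : ℕ) : Finset (Fin n) :=
  Finset.univ.filter fun a => vertex γ (j + 1) a ≠ vertex γ j a

theorem vertex_succ_of_lt {γ : Gallery n} {j : ℕ} (hj : j < γ.length) :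
    vertex γ (j + 1) = vertex γ j + columnCoweight γ[j] := by
  rw [vertex, vertex, List.take_add_one, List.getElem?_eq_getElem hj, Option.toList_some,
    List.map_append, List.sum_append, List.map_singleton, List.sum_singleton]

theorem vertex_succ_of_le {γ : Gallery n} {j : ℕ} (hj : γ.length ≤ j) :
    vertex γ (j + 1) = vertex γ j := by
  rw [vertex, vertex, List.take_of_length_le hj, List.take_of_length_le (by omega)]

/-- Beyond the end of the gallery the vertices are constant and the support is empty, so the formula
needs no bound on `j`. This allows sequences indexed by `ℕ` below. -/
theorem vertex_succ_apply (γ : Gallery n) (j : ℕ) (a : Fin n) :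
    vertex γ (j + 1) a = vertex γ j a + if a ∈ columnSupport γ j then 1 else 0 := by
  simp only [columnSupport, Finset.mem_filter, Finset.mem_univ, true_and]
  rcases lt_or_ge j γ.length with hj | hj
  · rw [vertex_succ_of_lt hj, Pi.add_apply, columnCoweight]
    split_ifs <;> simp_all
  · rw [vertex_succ_of_le hj]
    simp

theorem segmentGroup_eq (γ : Gallery n) (j : ℕ) :
    segmentGroup γ j = parahoric (vertex γ j) ⊓ parahoric (vertex γ (j + 1)) := by
  rw [segmentGroup]
  split_ifs with h
  · rfl
  · rw [vertex_succ_of_le (not_lt.1 h), inf_idem]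

/-- The successive remainders of a sequence of elements of parahoric subgroups, after splitting
off the components in the opposite root subgroups. -/
def remainder (γ : Gallery n) (P : ℕ → SL(n, 𝒦)) : ℕ → SL(n, 𝒦)
  | 0 => 1
  | j + 1 => (bigCellPart (vertex γ j) (columnSupport γ j) (remainder γ P j * P j))⁻¹ *
      (remainder γ P j * P j)

/-- The `j`-th component in the opposite root subgroups. -/
def coordinate (γ : Gallery n) (P : ℕ → SL(n, 𝒦)) (j : ℕ) : SL(n, 𝒦) :=
  bigCellPart (vertex γ j) (columnSupport γ j) (remainder γ P j * P j)

/-- The condition that the first `m` components of a sequence lie in the big cells. -/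
def InBigCells (γ : Gallery n) (P : ℕ → SL(n, 𝒦)) (m : ℕ) : Prop :=
  ∀ j < m, InBigCell (vertex γ j) (columnSupport γ j) (remainder γ P j * P j)

variable {γ : Gallery n} {P P' q : ℕ → SL(n, 𝒦)}

theorem remainder_succ (j : ℕ) :
    remainder γ P (j + 1) = (coordinate γ P j)⁻¹ * (remainder γ P j * P j) := rfl

theorem remainder_mem (hP : ∀ j, P j ∈ parahoric (vertex γ j)) {m : ℕ} (h : InBigCells γ P m) :
    remainder γ P m ∈ parahoric (vertex γ m) := by
  induction m with
  | zero => exact one_mem _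
  | succ m ih =>
    exact (bigCellPart_inv_mul_mem (vertex_succ_apply γ m)
      (mul_mem (ih fun j hj => h j (by omega)) (hP m)) (h m (by omega))).2

theorem prod_eq_prod_coordinate_mul (m : ℕ) : ((List.range m).map P).prod =
    ((List.range m).map (coordinate γ P)).prod * remainder γ P m := by
  induction m with
  | zero => simp [remainder]
  | succ m ih =>
    rw [List.prod_range_succ, List.prod_range_succ, ih, remainder_succ]
    simp only [mul_assoc, mul_inv_cancel_left]

/-- A factor `q m` on the right does not change the big cell component, so it passes into the next
remainder, where it cancels against the `(q m)⁻¹` in front of `P (m + 1)`. -/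
theorem remainder_mul_eq (hP : ∀ j, P j ∈ parahoric (vertex γ j))
    (hq : ∀ j, q j ∈ parahoric (vertex γ j) ⊓ parahoric (vertex γ (j + 1))) {m : ℕ}
    (h0 : P' 0 = P 0 * q 0) (h1 : ∀ j < m, P' (j + 1) = (q j)⁻¹ * P (j + 1) * q (j + 1))
    (h : InBigCells γ P m) :
    remainder γ P' m * P' m = remainder γ P m * P m * q m := by
  induction m with
  | zero => simp only [remainder, one_mul, h0]
  | succ m ih =>
    have h' : InBigCells γ P m := fun j hj => h j (by omega)
    have e := ih (fun j hj => h1 j (by omega)) h'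
    have hb := bigCellPart_mul (vertex_succ_apply γ m) (mul_mem (remainder_mem hP h') (hP m))
      (hq m)
    rw [remainder, e, hb, h1 m (by omega), remainder]
    simp only [mul_assoc, mul_inv_cancel_left]

theorem inBigCells_of_rel (hP : ∀ j, P j ∈ parahoric (vertex γ j))
    (hq : ∀ j, q j ∈ parahoric (vertex γ j) ⊓ parahoric (vertex γ (j + 1))) {m : ℕ}
    (h0 : P' 0 = P 0 * q 0) (h1 : ∀ j < m, P' (j + 1) = (q j)⁻¹ * P (j + 1) * q (j + 1))
    (h : InBigCells γ P m) : InBigCells γ P' m := by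
  intro j hj
  have h' : InBigCells γ P j := fun i hi => h i (by omega)
  rw [remainder_mul_eq hP hq h0 (fun i hi => h1 i (by omega)) h']
  exact inBigCell_mul (vertex_succ_apply γ j) (mul_mem (remainder_mem hP h') (hP j)) (hq j)
    (h j hj)

theorem coordinate_eq_of_rel (hP : ∀ j, P j ∈ parahoric (vertex γ j))
    (hq : ∀ j, q j ∈ parahoric (vertex γ j) ⊓ parahoric (vertex γ (j + 1))) {m : ℕ}
    (h0 : P' 0 = P 0 * q 0) (h1 : ∀ j < m, P' (j + 1) = (q j)⁻¹ * P (j + 1) * q (j + 1))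
    (h : InBigCells γ P m) : coordinate γ P' m = coordinate γ P m := by
  rw [coordinate, remainder_mul_eq hP hq h0 h1 h]
  exact bigCellPart_mul (vertex_succ_apply γ m) (mul_mem (remainder_mem hP h) (hP m)) (hq m)

/-- The component is conjugated by `η(s)`; removing it from `η(s)` times the old element leaves
`η(s)` in front of the next remainder. -/
theorem remainder_mul_eval (η : AntidominantCocharacter n) (s : ℂˣ) (h0 : P' 0 = η.eval s * P 0)
    (h1 : ∀ j, P' (j + 1) = P (j + 1)) (j : ℕ) :
    remainder γ P' j * P' j = η.eval s * (remainder γ P j * P j) := by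
  induction j with
  | zero => simp only [remainder, one_mul, h0]
  | succ j ih =>
    rw [remainder, ih, bigCellPart_eval_mul, h1, remainder]
    group

theorem inBigCells_eval (η : AntidominantCocharacter n) (s : ℂˣ) (h0 : P' 0 = η.eval s * P 0)
    (h1 : ∀ j, P' (j + 1) = P (j + 1)) {m : ℕ} : InBigCells γ P' m ↔ InBigCells γ P m := by
  refine forall₂_congr fun j _ => ?_
  rw [remainder_mul_eval η s h0 h1, inBigCell_eval_mul]

theorem coordinate_eval (η : AntidominantCocharacter n) (s : ℂˣ) (h0 : P' 0 = η.eval s * P 0)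
    (h1 : ∀ j, P' (j + 1) = P (j + 1)) (j : ℕ) :
    coordinate γ P' j = η.eval s * coordinate γ P j * (η.eval s)⁻¹ := by
  rw [coordinate, remainder_mul_eval η s h0 h1, bigCellPart_eval_mul, coordinate]

theorem remainder_one (j : ℕ) : remainder γ (fun _ => 1) j = 1 := by
  induction j with
  | zero => rfl
  | succ j ih =>
    rw [remainder, ih, one_mul, mul_one, inv_eq_one, bigCellPart, slope, reduction_one, mul_one,
      sub_mul, one_mul, coordProj_mul_self, sub_self, zero_mul]
    refine specialLinear_ext_coeff fun a b k => ?_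
    rw [coeff_oppositeElement]
    by_cases hab : a = b <;> simp [hab, HahnSeries.coeff_one]

theorem inBigCells_one (m : ℕ) : InBigCells γ (fun _ => 1) m := by
  intro j _
  rw [remainder_one, one_mul]
  exact inBigCell_one

theorem coordinate_one (j : ℕ) : coordinate γ (fun _ => 1) j = 1 := by
  have h := remainder_succ (γ := γ) (P := fun _ => 1) j
  rw [remainder_one, remainder_one, one_mul, mul_one] at h
  exact inv_eq_one.1 h.symm

/-! ### Continuity of the coordinates -/

theorem continuousOn_reduction {X : Type*} [TopologicalSpace X] {O : Set X} (μ : Fin n → ℤ)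
    {F : X → SL(n, 𝒦)} (cF : ∀ a b k, ContinuousOn (fun x => (F x a b).coeff k) O) :
    ContinuousOn (fun x => reduction μ (F x)) O :=
  continuousOn_pi.2 fun a => continuousOn_pi.2 fun b => cF a b _

theorem continuous_blockCompletion (S : Finset (Fin n)) : Continuous (blockCompletion S) := by
  unfold blockCompletion
  fun_prop

theorem continuousOn_slope (S : Finset (Fin n)) :
    ContinuousOn (slope S) {H | (blockCompletion S H).det ≠ 0} := by
  have h := continuous_blockCompletion S
  have h' : ContinuousOn (fun H => (blockCompletion S H)⁻¹)
      {H | (blockCompletion S H).det ≠ 0} := by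
    simp only [Matrix.inv_def, Ring.inverse_eq_inv']
    exact (h.matrix_det.continuousOn.inv₀ fun _ hx => hx).smul h.matrix_adjugate.continuousOn
  unfold slope
  exact (Continuous.continuousOn (by fun_prop)).mul h'

theorem continuousOn_coeff_bigCellPart {X : Type*} [TopologicalSpace X] {O : Set X}
    {μ : Fin n → ℤ} {S : Finset (Fin n)} {F : X → SL(n, 𝒦)}
    (cF : ∀ a b k, ContinuousOn (fun x => (F x a b).coeff k) O)
    (hF : ∀ x ∈ O, InBigCell μ S (F x)) (a b : Fin n) (k : ℤ) :
    ContinuousOn (fun x => ((bigCellPart μ S (F x))⁻¹ a b).coeff k) O ∧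
    ContinuousOn (fun x => (bigCellPart μ S (F x) a b).coeff k) O := by
  have h : ContinuousOn (fun x => slope S (reduction μ (F x)) a b) O :=
    continuousOn_pi.1 (continuousOn_pi.1
      ((continuousOn_slope S).comp (continuousOn_reduction μ cF) hF) a) b
  simp only [bigCellPart, inv_oppositeElement, coeff_oppositeElement]
  split_ifs
  · exact ⟨continuousOn_const.add h.neg, continuousOn_const.add h⟩
  · exact ⟨continuousOn_const, continuousOn_const⟩
  · exact ⟨continuousOn_const.add h.neg, continuousOn_const.add h⟩
  · exact ⟨continuousOn_const, continuousOn_const⟩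

/-- The sequence of the components of a point of `𝒫_{μ_0} × ⋯ × 𝒫_{μ_r}`, extended by `1`. -/
def components (p : ParahoricProduct γ) (j : ℕ) : SL(n, 𝒦) :=
  if h : j < γ.length + 1 then p ⟨j, h⟩ else 1

theorem components_mem (p : ParahoricProduct γ) (j : ℕ) :
    components p j ∈ parahoric (vertex γ j) := by
  unfold components
  split_ifs with h
  · exact (p ⟨j, h⟩).2
  · exact one_mem _

theorem components_val (p : ParahoricProduct γ) (j : Fin (γ.length + 1)) :
    components p j = p j :=
  dif_pos j.2

theorem continuous_coeff_components (j : ℕ) (a b : Fin n) (k : ℤ) :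
    Continuous fun p : ParahoricProduct γ => (components p j a b).coeff k := by
  unfold components
  split_ifs with h
  · have h1 : Continuous fun (p : ParahoricProduct γ) (j : Fin (γ.length + 1)) (a b : Fin n)
        (k : ℤ) => ((p j : SL(n, 𝒦)) a b).coeff k := continuous_induced_dom
    exact continuous_pi_iff.1 (continuous_pi_iff.1 (continuous_pi_iff.1
      (continuous_pi_iff.1 h1 ⟨j, h⟩) a) b) k
  · exact continuous_const

/-- Both claims must be proved together: the next big cell condition is open because the current
remainder is continuous, and the next remainder is continuous only where that condition holds. -/
theorem isOpen_inBigCells_and_continuousOn (γ : Gallery n) (m : ℕ) :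
    IsOpen {p : ParahoricProduct γ | InBigCells γ (components p) m} ∧ ∀ a b k,
      ContinuousOn (fun p => (remainder γ (components p) m a b).coeff k)
        {p : ParahoricProduct γ | InBigCells γ (components p) m} := by
  induction m with
  | zero =>
    refine ⟨?_, fun a b k => (continuousOn_const :
      ContinuousOn (fun _ => ((1 : SL(n, 𝒦)) a b).coeff k) _)⟩
    convert isOpen_univ
    simp [InBigCells]
  | succ m ih =>
    have hc := continuousOn_coeff_mul (fun p hp => remainder_mem (components_mem p) hp)
      (fun p _ => components_mem p m) ih.2
      fun a b k => (continuous_coeff_components m a b k).continuousOn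
    have hset : {p : ParahoricProduct γ | InBigCells γ (components p) (m + 1)} =
        {p | InBigCells γ (components p) m} ∩
          {p | InBigCell (vertex γ m) (columnSupport γ m)
            (remainder γ (components p) m * components p m)} := by
      ext p
      exact ⟨fun h => ⟨fun j hj => h j (by omega), h m (by omega)⟩, fun h j hj =>
        (Nat.lt_succ_iff_lt_or_eq.1 hj).elim (h.1 j) fun e => e ▸ h.2⟩
    have hsub : {p : ParahoricProduct γ | InBigCells γ (components p) (m + 1)} ⊆
        {p | InBigCells γ (components p) m} := hset ▸ Set.inter_subset_left
    constructor
    · rw [hset]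
      exact ((continuous_blockCompletion _).matrix_det.comp_continuousOn
        (continuousOn_reduction _ hc)).isOpen_inter_preimage ih.1 isOpen_ne
    · have hc' := fun a b k => (hc a b k).mono hsub
      refine continuousOn_coeff_mul (μ := vertex γ m)
        (fun p hp => inv_mem (oppositeElement_mem _ _ _))
        (fun p hp => mul_mem (remainder_mem (components_mem p) (hsub hp)) (components_mem p m))
        (fun a b k => (continuousOn_coeff_bigCellPart hc'
          (fun p (hp : InBigCells γ (components p) (m + 1)) => hp m (by omega)) a b k).1)
        hc'

theorem continuousOn_coeff_coordinate (γ : Gallery n) {j m : ℕ} (hj : j < m) (a b : Fin n)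
    (k : ℤ) : ContinuousOn (fun p => (coordinate γ (components p) j a b).coeff k)
      {p : ParahoricProduct γ | InBigCells γ (components p) m} := by
  have hsub : {p : ParahoricProduct γ | InBigCells γ (components p) m} ⊆
      {p | InBigCells γ (components p) j} := fun p hp i hi => hp i (by omega)
  refine (continuousOn_coeff_bigCellPart (fun a b k => ?_)
    (fun p (hp : InBigCells γ (components p) m) => hp j hj) a b k).2
  exact (continuousOn_coeff_mul (fun p hp => remainder_mem (components_mem p) hp)
      (fun p _ => components_mem p j) (isOpen_inBigCells_and_continuousOn γ j).2
      (fun a b k => (continuous_coeff_components j a b k).continuousOn) a b k).mono hsub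

/-! ### The cell and its image -/

theorem headProduct_eq (p : ParahoricProduct γ) :
    headProduct p = ((List.range γ.length).map (components p)).prod := by
  have h : ∀ (m : ℕ) (hm : m < γ.length + 1),
      Fin.partialProd (fun j : Fin γ.length => (p j.castSucc : SL(n, 𝒦))) ⟨m, hm⟩ =
        ((List.range m).map (components p)).prod := by
    intro m
    induction m with
    | zero => exact fun _ => Fin.partialProd_zero _
    | succ m ih =>
      intro hm
      rw [List.prod_range_succ, ← ih (by omega)]
      have e := Fin.partialProd_succ (fun j : Fin γ.length => (p j.castSucc : SL(n, 𝒦)))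
        ⟨m, by omega⟩
      rw [← components_val] at e
      exact e
  exact h _ _

theorem components_zero (p : ParahoricProduct γ) : components p 0 = p 0 := components_val p 0

theorem exists_rel_components {p p' : ParahoricProduct γ} (h : BottSamelsonRel γ p p') :
    ∃ q : ℕ → SL(n, 𝒦), (∀ j, q j ∈ parahoric (vertex γ j) ⊓ parahoric (vertex γ (j + 1))) ∧
      components p' 0 = components p 0 * q 0 ∧ ∀ j < γ.length,
        components p' (j + 1) = (q j)⁻¹ * components p (j + 1) * q (j + 1) := by
  obtain ⟨q, h0, h1⟩ := h
  let q' : ℕ → SL(n, 𝒦) := fun j => if hj : j < γ.length + 1 then q ⟨j, hj⟩ else 1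
  have hq' : ∀ j : Fin (γ.length + 1), q' j = q j := fun j => dif_pos j.2
  refine ⟨q', fun j => ?_, ?_, fun j hj => ?_⟩
  · rw [← segmentGroup_eq]
    simp only [q']
    split_ifs with hj
    · exact (q ⟨j, hj⟩).2
    · exact one_mem _
  · rw [components_zero, components_zero, h0]
    exact congrArg _ (hq' 0).symm
  · have e := h1 ⟨j, hj⟩
    rw [← components_val, ← components_val, ← hq', ← hq'] at e
    exact e

/-- A saturated open set is the preimage of an open set of the quotient, so the limit in the
Bott-Samelson variety can be tested on representatives. -/
theorem eventually_torusAct_mem {η : AntidominantCocharacter n} {p : ParahoricProduct γ}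
    (hp : BottSamelson.mk p ∈ cell η γ) {W : Set (ParahoricProduct γ)} (hW : IsOpen W)
    (hsat : ∀ p p', BottSamelsonRel γ p p' → p ∈ W → p' ∈ W) (h1 : (fun _ => 1) ∈ W) :
    ∀ᶠ s in comap (fun s : ℂˣ => (s : ℂ)) (𝓝 0), torusActProduct η s p ∈ W := by
  have hpre : BottSamelson.mk ⁻¹' (BottSamelson.mk '' W) = W := by
    refine Set.Subset.antisymm ?_ (Set.subset_preimage_image _ _)
    rintro x ⟨y, hy, hxy⟩
    exact hsat y x (Quotient.exact hxy) hy
  have hopen : IsOpen (BottSamelson.mk '' W) := isOpen_coinduced.2 (by rwa [hpre])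
  filter_upwards [hp (hopen.mem_nhds ⟨_, h1, rfl⟩)] with s hs
  rw [← hpre]
  exact hs

theorem torusActProduct_zero (η : AntidominantCocharacter n) (s : ℂˣ)
    (p : ParahoricProduct γ) : (torusActProduct η s p 0 : SL(n, 𝒦)) = η.eval s * p 0 := by
  have e : torusActProduct η s p 0 = ⟨η.eval s, η.eval_mem s _⟩ * p 0 :=
    Function.update_self _ _ _
  rw [e]
  rfl

theorem torusActProduct_of_ne (η : AntidominantCocharacter n) (s : ℂˣ)
    (p : ParahoricProduct γ) {j : Fin (γ.length + 1)} (hj : j ≠ 0) :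
    torusActProduct η s p j = p j :=
  Function.update_of_ne hj _ _

theorem components_torusActProduct_zero (η : AntidominantCocharacter n) (s : ℂˣ)
    (p : ParahoricProduct γ) :
    components (torusActProduct η s p) 0 = η.eval s * components p 0 := by
  rw [components_zero, components_zero, torusActProduct_zero]

theorem components_torusActProduct_succ (η : AntidominantCocharacter n) (s : ℂˣ)
    (p : ParahoricProduct γ) (j : ℕ) :
    components (torusActProduct η s p) (j + 1) = components p (j + 1) := by
  unfold components
  split_ifs with h
  · rw [torusActProduct_of_ne]
    exact fun e => absurd (congrArg Fin.val e) (Nat.succ_ne_zero j)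
  · rfl

theorem components_one (γ : Gallery n) :
    components (γ := γ) (fun _ => 1) = fun _ => 1 := by
  funext j
  unfold components
  split_ifs <;> rfl

instance neBot_comap_units : (comap (fun s : ℂˣ => (s : ℂ)) (𝓝 0)).NeBot := by
  refine comap_neBot fun t ht => ?_
  obtain ⟨x, hx, hx0⟩ := ((eventually_nhdsWithin_of_eventually_nhds ht).and
    (self_mem_nhdsWithin (a := (0 : ℂ)) (s := {0}ᶜ))).exists
  exact ⟨Units.mk0 x hx0, hx⟩

/-- The coordinates of a point of the cell are lower unitriangular. -/
theorem inBigCells_and_coordinate_mem {η : AntidominantCocharacter n} {p : ParahoricProduct γ}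
    (hp : BottSamelson.mk p ∈ cell η γ) : InBigCells γ (components p) γ.length ∧
      ∀ j < γ.length, coordinate γ (components p) j ∈ lowerParahoric (vertex γ j) := by
  have hopen := (isOpen_inBigCells_and_continuousOn γ γ.length).1
  have hsat : ∀ p p' : ParahoricProduct γ, BottSamelsonRel γ p p' →
      InBigCells γ (components p) γ.length → InBigCells γ (components p') γ.length := by
    intro p p' h
    obtain ⟨q, hq, h0, h1⟩ := exists_rel_components h
    exact inBigCells_of_rel (components_mem p) hq h0 h1
  have hone : InBigCells γ (components (γ := γ) (fun _ => 1)) γ.length := by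
    rw [components_one]
    exact inBigCells_one _
  -- The big cell locus is stable under the torus, so a single `s` that moves the point into it
  -- suffices.
  have hcells : InBigCells γ (components p) γ.length := by
    obtain ⟨s, hs⟩ := (eventually_torusAct_mem hp hopen hsat hone).exists
    exact (inBigCells_eval η s (components_torusActProduct_zero η s p)
      (components_torusActProduct_succ η s p)).1 hs
  refine ⟨hcells, fun j hj => ⟨oppositeElement_mem _ _ _, ?_⟩⟩
  have hlt : ∀ a b k, a < b → (coordinate γ (components p) j a b).coeff k = 0 := by
    intro a b k hab
    by_contra hne
    let f : ParahoricProduct γ → ℂ := fun p => (coordinate γ (components p) j a b).coeff k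
    have hf : f (fun _ => 1) = 0 := by
      simp only [f, components_one, coordinate_one]
      simp [hab.ne]
    -- The coefficient is `0` at the limit point, so it should eventually have norm less than `‖f
    -- p‖`. For `‖s‖ < 1` it is however multiplied by a nonpositive power of `s`, which cannot
    -- decrease its norm.
    have hW := (continuousOn_coeff_coordinate γ hj a b k).isOpen_inter_preimage hopen
      (Metric.isOpen_ball (x := (0 : ℂ)) (ε := ‖f p‖))
    have hev := eventually_torusAct_mem hp hW
      (by
        rintro p p' h ⟨hp1, hp2⟩
        refine ⟨hsat p p' h hp1, ?_⟩
        obtain ⟨q, hq, h0, h1⟩ := exists_rel_components h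
        rw [Set.mem_preimage, coordinate_eq_of_rel (components_mem p) hq h0
          (fun i hi => h1 i (by omega)) fun i hi => hp1 i (by omega)]
        exact hp2)
      ⟨hone, by
        change f (fun _ => 1) ∈ Metric.ball 0 ‖f p‖
        rw [hf]
        exact Metric.mem_ball_self (norm_pos_iff.2 hne)⟩
    have hsmall : ∀ᶠ s : ℂˣ in comap (fun s : ℂˣ => (s : ℂ)) (𝓝 0), ‖(s : ℂ)‖ < 1 :=
      tendsto_comap.eventually (by
        filter_upwards [Metric.ball_mem_nhds (0 : ℂ) one_pos] with x hx
        simpa using hx)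
    obtain ⟨s, ⟨_, hs⟩, hs1⟩ := (hev.and hsmall).exists
    rw [Set.mem_preimage, coordinate_eval η s (components_torusActProduct_zero η s p)
      (components_torusActProduct_succ η s p), coeff_eval_conj, mem_ball_zero_iff, norm_mul,
      norm_zpow] at hs
    have hge : (1 : ℝ) ≤ ‖(s : ℂ)‖ ^ (η.exponent a - η.exponent b) :=
      one_le_zpow_of_nonpos₀ (norm_pos_iff.2 s.ne_zero) hs1.le (η.antidominant a b hab).le
    exact absurd hs (not_lt.2 (le_mul_of_one_le_left (norm_nonneg _) hge))
  intro a b hab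
  rcases hab.lt_or_eq with h | rfl
  · rw [if_neg h.ne]
    ext k
    exact hlt a b k h
  · rw [if_pos rfl]
    ext k
    rw [coordinate, bigCellPart, coeff_oppositeElement, HahnSeries.coeff_one,
      if_neg (c := (a ∉ _ ∧ a ∈ _) ∧ _) fun h => h.1.1 h.1.2, add_zero]
    simp

/-- Conjugation by `η(s)` on all factors. -/
def torusConj (η : AntidominantCocharacter n) (s : ℂˣ) (p : ParahoricProduct γ) :
    ParahoricProduct γ :=
  fun j => ⟨η.eval s, η.eval_mem s _⟩ * p j * ⟨η.eval s, η.eval_mem s _⟩⁻¹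

/-- The torus lies in every `𝒬_j`, so acting with all `q_j = η(s)⁻¹` turns left multiplication on
the first factor into conjugation on all factors. -/
theorem torusAct_mk (η : AntidominantCocharacter n) (s : ℂˣ) (p : ParahoricProduct γ) :
    torusAct η s (BottSamelson.mk p) = BottSamelson.mk (torusConj η s p) := by
  refine Quotient.sound (s := bottSamelsonSetoid γ) ⟨fun j => ⟨(η.eval s)⁻¹, ?_⟩, ?_, fun j => ?_⟩
  · rw [segmentGroup_eq]
    exact inv_mem ⟨η.eval_mem s _, η.eval_mem s _⟩
  · rw [torusActProduct_zero]
    rfl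
  · rw [torusActProduct_of_ne η s p (Fin.succ_ne_zero j), inv_inv]
    rfl

/-- Conjugation multiplies the entries below the diagonal by positive powers of `s`, so the
representatives themselves converge to `1`, coefficient by coefficient. -/
theorem mk_mem_cell (η : AntidominantCocharacter n) {p : ParahoricProduct γ}
    (hp : ∀ j : Fin (γ.length + 1), (p j : SL(n, 𝒦)) ∈ lowerParahoric (vertex γ j)) :
    BottSamelson.mk p ∈ cell η γ := by
  have hc : Continuous (BottSamelson.mk : ParahoricProduct γ → BottSamelson γ) :=
    continuous_coinduced_rng
  change Tendsto (fun s => torusAct η s (BottSamelson.mk p)) _ _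
  simp only [torusAct_mk]
  refine (hc.tendsto (fun _ => 1)).comp ?_
  have hi : IsInducing fun (p : ParahoricProduct γ) (j : Fin (γ.length + 1)) (a b : Fin n)
      (k : ℤ) => ((p j : SL(n, 𝒦)) a b).coeff k := ⟨rfl⟩
  refine hi.tendsto_nhds_iff.2 ?_
  refine tendsto_pi_nhds.2 fun j => tendsto_pi_nhds.2 fun a => tendsto_pi_nhds.2 fun b =>
    tendsto_pi_nhds.2 fun k => ?_
  change Tendsto (fun s : ℂˣ => ((η.eval s * p j * (η.eval s)⁻¹) a b).coeff k) _
    (𝓝 (((1 : SL(n, 𝒦)) a b).coeff k))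
  simp only [coeff_eval_conj]
  rcases le_or_gt a b with hab | hab
  · rw [(hp j).2 a b hab]
    refine tendsto_const_nhds.congr fun s => ?_
    rw [Matrix.SpecialLinearGroup.coe_one, Matrix.one_apply]
    split_ifs with h
    · rw [h, sub_self, zpow_zero, one_mul]
    · simp
  · obtain ⟨m, hm⟩ := Int.eq_ofNat_of_zero_le
      (show 0 ≤ η.exponent a - η.exponent b by linarith [η.antidominant b a hab])
    have hm0 : m ≠ 0 := by
      rintro rfl
      have := η.antidominant b a hab
      omega
    have h0 : ((1 : SL(n, 𝒦)) a b).coeff k = 0 := by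
      simp [hab.ne']
    rw [h0, hm]
    simp only [zpow_natCast]
    have h1 : Tendsto (fun x : ℂ => x ^ m * ((p j : SL(n, 𝒦)) a b).coeff k) (𝓝 0) (𝓝 0) := by
      have := ((continuous_pow m).mul_const (((p j : SL(n, 𝒦)) a b).coeff k)).tendsto (0 : ℂ)
      simpa [hm0] using this
    exact h1.comp tendsto_comap

/-! ### The image of the cell as a product of groups applied to the end point -/

theorem loopAct_mul (g h : SL(n, 𝒦)) (x : AffineGrassmannian n) :
    loopAct (g * h) x = loopAct g (loopAct h x) := by
  rw [loopAct, map_mul, mul_smul]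
  rfl

theorem desingularization_mk (p : ParahoricProduct γ) :
    desingularization γ (BottSamelson.mk p) =
      loopAct ((List.range γ.length).map (components p)).prod
        (coweightPoint (vertex γ γ.length)) := by
  rw [← headProduct_eq]
  rfl

theorem cellImage_eq (η : AntidominantCocharacter n) (γ : Gallery n) :
    cellImage η γ = (fun g => loopAct g (coweightPoint (vertex γ γ.length))) ''
      gallerySet 0 γ := by
  ext x
  constructor
  · rintro ⟨y, hy, rfl⟩
    obtain ⟨p, rfl⟩ : ∃ p, BottSamelson.mk p = y := Quotient.exists_rep y
    obtain ⟨h, hl⟩ := inBigCells_and_coordinate_mem hy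
    -- There are `r` coordinates but `r + 1` vertices; the last factor is taken to be `1`.
    refine ⟨((List.range γ.length).map (coordinate γ (components p))).prod,
      mem_gallerySet.2 ⟨fun j => if j < γ.length then coordinate γ (components p) j else 1,
        fun j => ?_, ?_⟩, ?_⟩
    · rw [zero_add]
      beta_reduce
      split_ifs with hj
      · exact hl j hj
      · exact one_mem _
    · rw [List.prod_range_succ, if_neg (lt_irrefl _), mul_one]
      refine congrArg List.prod (List.map_congr_left fun j hj => ?_)
      rw [if_pos (List.mem_range.1 hj)]
    · rw [desingularization_mk, prod_eq_prod_coordinate_mul (γ := γ) (P := components p), loopAct_mul,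
        loopAct_coweightPoint _ _ (remainder_mem (components_mem p) h)]
  · rintro ⟨g, hg, rfl⟩
    obtain ⟨u, hu, rfl⟩ := mem_gallerySet.1 hg
    simp only [zero_add] at hu
    let p : ParahoricProduct γ := fun j => ⟨u j, (hu j).1⟩
    refine ⟨BottSamelson.mk p, mk_mem_cell η fun j => hu j, ?_⟩
    rw [desingularization_mk]
    change _ = loopAct _ _
    -- The factor at the last vertex fixes the end point, which matches the absence of `p_r` in the
    -- definition of `π`.
    rw [List.prod_range_succ, loopAct_mul, loopAct_coweightPoint _ _ (hu γ.length).1]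
    congr 2
    refine List.map_congr_left fun j hj => ?_
    rw [List.mem_range] at hj
    exact components_val p ⟨j, by omega⟩

end LoopGallery
end

theorem mainTheorem3 (n : ℕ) (η : LoopGallery.AntidominantCocharacter n)
    (γ γ' : LoopGallery.Gallery n) (hw : γ.word = γ'.word) :
    LoopGallery.cellImage η γ = LoopGallery.cellImage η γ' := by
  rw [LoopGallery.cellImage_eq, LoopGallery.cellImage_eq, LoopGallery.vertex_length,
    LoopGallery.vertex_length, LoopGallery.gallerySet_eq_wordSet,
    LoopGallery.gallerySet_eq_wordSet, hw]
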